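/- **Setting.** Let $\Omega\subset\mathbb R^2$ be a (bounded or unbounded) domain with smooth boundary. Let $\varphi:\mathbb R\to\partial\Omega$ be a smooth curve with $|\partial_s\varphi|=1$ whose tangent angle $\theta$, $\partial_s\varphi=(\cos\theta,\sin\theta)$, is continuous and non-increasing. Let $\bar s_0<0<\bar s_2$ and $\delta>0$ be such that $\varphi(\bar s_0)=(0,0)$, $\theta(\bar s_0)=0$, the curvature $|\partial_s^2\varphi|$ is non-decreasing on $[\bar s_0,0]$, and $|\partial_s^2\varphi|=1/\delta$ on $[0,\bar s_2]$. Write $(a,b)^\perp=(-b,a)$ and $\Phi(s,r)=\varphi(s)+r(\partial_s\varphi(s))^\perp$, and assume that $\Phi(s,r)\in\Omega$ for $s\in[\bar s_0,\bar s_2]$ and all sufficiently small $r>0$ (uniformly in $s$). A velocity field $v$ on $\Omega$ is called a *parallel laminar flow* near $\varphi([\bar s_0,\bar s_2])$ if there are $\rho,\varepsilon>0$ such that: - for $s\in[\bar s_0,\bar s_2]$ and $0<r<\rho$: $v(\Phi(s,r))\neq0$ and $\langle\partial_s\varphi(s),\frac{v}{|v|}(\Phi(s,r))\rangle>0$; -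 for $s,s_1\in[\bar s_0,\bar s_2]$ with $s<s_1<s+\varepsilon$ and $0<r<\rho$: the normalized streamline $\gamma$ in $\Omega$ ($\gamma'=\frac{v}{|v|}(\gamma)$, $\gamma(0)=\Phi(s,r)$) meets the normal line $\{\Phi(s_1,\tau):\tau\in\mathbb R\}$, and at its first meeting, at the point $\Phi(s_1,L(r))$, one has $L(r)/r=1$. **Theorem (non-stationary case).** Let $\nu,\alpha_1,\alpha_2,T>0$, and let $(u,p)$ be a classical solution on $[0,T)$ of $$\partial_tu-\nu\Delta u+(u\cdot\nabla)u=-\nabla p,\quad \operatorname{div}u=0\ \text{ in }\Omega,\qquad u|_{\partial\Omega}=0,\qquad u|_{t=0}=u_0 .$$ Here a classical solution means: $u$ is $C^1$ on $[0,T)\times\overline\Omega$, $u(t,\cdot)$ is $C^2$ and $p(t,\cdot)$ is $C^1$ in $\Omega$ for each $t\in[0,T)$, and the equations hold for all $t\in[0,T)$, with the one-sided time derivative at $t=0$; every solution which is smooth on $[0,T)\times\overline\Omega$ is one. Assume that $u_0$ and $p|_{t=0}$ are smooth on $\overline\Omega$, that $u_0$ is a parallel laminar flow near $\varphi([\bar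 s_0,\bar s_2])$, and that $$u_0(0,x_2)=\bigl(h(x_2),0\bigr),\qquad h(x_2)=\alpha_1x_2-\tfrac{\alpha_2}{2}x_2^2,\qquad\text{for all sufficiently small }x_2>0.$$ Then, with the material derivative $D_tu=\partial_tu+(u\cdot\nabla)u$, for every $s\in[0,\bar s_2]$ $$\lim_{\substack{x\to\varphi(s)\\ x\in\Omega}}\frac{\langle D_tu(x,t)|_{t=0},\partial_s\varphi(s)\rangle}{\langle u_0(x),\partial_s\varphi(s)\rangle}=-\frac{2\nu\alpha_2}{\delta\alpha_1}-\frac{\nu}{\delta^2}<0 .$$ So the material derivative opposes the initial flow. The effect grows with the curvature: the value $-\frac{2\nu\alpha_2}{\delta\alpha_1}-\frac{\nu}{\delta^2}$ is smaller for smaller $\delta>0$. -/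

import Mathlib

open Set Filter Topology
open scoped ContDiff RealInnerProductSpace

noncomputable section

namespace LaminarFlow

/-- The Euclidean plane. -/
abbrev Plane : Type := EuclideanSpace ℝ (Fin 2)

/-- Rotation by a right angle, counterclockwise (so that `(1, 0)` is sent to `(0, 1)`). -/
def perp (v : Plane) : Plane := !₂[-(v 1), v 0]

/-- The normal coordinates `Φ(s, r) = φ(s) + r (∂_s φ(s))^⊥` along the curve `φ`. -/
def normalCoord (φ : ℝ → Plane) (s r : ℝ) : Plane := φ s + r • perp (deriv φ s)

/-- A planar domain with smooth boundary: a connected (nonempty) open set which near each of its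
boundary points is the region where a smooth function with nonzero differential is positive. -/
structure IsSmoothDomain (Ω : Set Plane) : Prop where
  isOpen : IsOpen Ω
  isConnected : IsConnected Ω
  smooth_boundary : ∀ x ∈ frontier Ω, ∃ U : Set Plane, IsOpen U ∧ x ∈ U ∧
    ∃ g : Plane → ℝ, ContDiffOn ℝ ∞ g U ∧ g x = 0 ∧ (∀ y ∈ U, fderiv ℝ g y ≠ 0) ∧
      Ω ∩ U = {y ∈ U | 0 < g y}

/-- The boundary curve. `φ` is a smooth unit speed curve in `∂Ω`, its tangent angle `θ` does not
increase, it starts (at the parameter `s₀ < 0`) at the origin in the direction `(1, 0)`, its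
curvature does not decrease on `[s₀, 0]`, and is the constant `1 / δ` on `[0, s₂]`.
The domain lies on the side of the normal `(∂_s φ)^⊥`. -/
structure IsBoundaryCurve (Ω : Set Plane) (φ : ℝ → Plane) (s₀ s₂ δ : ℝ) : Prop where
  smooth : ContDiff ℝ ∞ φ
  unit_speed : ∀ s, ‖deriv φ s‖ = 1
  angle : ∃ θ : ℝ → ℝ, Continuous θ ∧ Antitone θ ∧ θ s₀ = 0 ∧
    ∀ s, deriv φ s = !₂[Real.cos (θ s), Real.sin (θ s)]
  mem_frontier : ∀ s, φ s ∈ frontier Ω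
  s₀_neg : s₀ < 0
  s₂_pos : 0 < s₂
  origin : φ s₀ = 0
  δ_pos : 0 < δ
  curvature_mono : MonotoneOn (fun s => ‖deriv (deriv φ) s‖) (Icc s₀ 0)
  curvature_arc : ∀ s ∈ Icc 0 s₂, ‖deriv (deriv φ) s‖ = 1 / δ
  interior_side : ∃ ρ > 0, ∀ s ∈ Icc s₀ s₂, ∀ r ∈ Ioo 0 ρ, normalCoord φ s r ∈ Ω

/-- `γ : [0, ℓ] → Ω` is a normalized streamline of `v`: `γ' = (v / |v|)(γ)`, and no stagnation
point of `v` is met. -/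
def IsStreamline (Ω : Set Plane) (v : Plane → Plane) (γ : ℝ → Plane) (ℓ : ℝ) : Prop :=
  ∀ t ∈ Icc 0 ℓ, γ t ∈ Ω ∧ v (γ t) ≠ 0 ∧
    HasDerivWithinAt γ (‖v (γ t)‖⁻¹ • v (γ t)) (Icc 0 ℓ) t

/-- The Poincaré map `L_{s, s₁}` as a graph: `L_{s, s₁}(r) = τ`, that is, the normalized streamline
starting at `Φ(s, r)` meets the normal line `Φ(s₁, ·)` for the first time, and does so at the
point `Φ(s₁, τ)`. -/
def IsPoincareValue (Ω : Set Plane) (v : Plane → Plane) (φ : ℝ → Plane) (s s₁ r τ : ℝ) : Prop :=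
  ∃ ℓ > 0, ∃ γ : ℝ → Plane, IsStreamline Ω v γ ℓ ∧ γ 0 = normalCoord φ s r ∧
    γ ℓ = normalCoord φ s₁ τ ∧ ∀ t ∈ Ioo 0 ℓ, ∀ τ' : ℝ, γ t ≠ normalCoord φ s₁ τ'

/-- `v` is a parallel laminar flow near `φ([s₀, s₂])`: there the flow has no stagnation point and
is directed to the right (the direction of `∂_s φ`), and the Poincaré maps between
sufficiently close normal lines satisfy `L(r) / r = 1`. -/
structure IsParallelLaminar (Ω : Set Plane) (v : Plane → Plane) (φ : ℝ → Plane)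
    (s₀ s₂ : ℝ) : Prop where
  rightward : ∃ ρ > 0, ∀ s ∈ Icc s₀ s₂, ∀ r ∈ Ioo 0 ρ,
    v (normalCoord φ s r) ≠ 0 ∧
      0 < ⟪deriv φ s, ‖v (normalCoord φ s r)‖⁻¹ • v (normalCoord φ s r)⟫
  parallel : ∃ ρ > 0, ∃ ε > 0, ∀ s ∈ Icc s₀ s₂, ∀ s₁ ∈ Icc s₀ s₂, s < s₁ → s₁ < s + ε →
    ∀ r ∈ Ioo 0 ρ, ∃ τ, IsPoincareValue Ω v φ s s₁ r τ ∧ τ / r = 1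

/-- The divergence of a planar vector field. -/
def divergence (v : Plane → Plane) (x : Plane) : ℝ :=
  ∑ i : Fin 2, (fderiv ℝ v x (EuclideanSpace.single i 1)) i

/-- The time derivative on `[0, ∞)` (one-sided at `t = 0`). -/
def timeDeriv (u : ℝ → Plane → Plane) (t : ℝ) (x : Plane) : Plane :=
  derivWithin (fun τ => u τ x) (Ici 0) t

/-- The material derivative `D_t u = ∂_t u + (u · ∇) u`. -/
def materialDeriv (u : ℝ → Plane → Plane) (t : ℝ) (x : Plane) : Plane :=
  timeDeriv u t x + fderiv ℝ (u t) x (u t x)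

/-- `(u, p)` is a classical solution on `[0, T)` of the Navier–Stokes equations in `Ω` with
viscosity `ν`, the no-slip boundary condition and the initial datum `u₀`. The velocity is `C¹` in
space and time up to the boundary and up to the initial time, and has the spatial regularity in
`Ω` which the equations need; solutions which are smooth on `[0, T) × closure Ω` are included. -/
structure IsNavierStokesSolution (ν : ℝ) (Ω : Set Plane) (T : ℝ) (u₀ : Plane → Plane)
    (u : ℝ → Plane → Plane) (p : ℝ → Plane → ℝ) : Prop where
  regular : ContDiffOn ℝ 1 (fun z : ℝ × Plane => u z.1 z.2) (Ico 0 T ×ˢ closure Ω)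
  regular_space : ∀ t ∈ Ico 0 T, ContDiffOn ℝ 2 (u t) Ω
  regular_pressure : ∀ t ∈ Ico 0 T, ContDiffOn ℝ 1 (p t) Ω
  momentum : ∀ t ∈ Ico 0 T, ∀ x ∈ Ω,
    timeDeriv u t x - ν • Laplacian.laplacian (u t) x + fderiv ℝ (u t) x (u t x)
      = -gradient (p t) x
  incompressible : ∀ t ∈ Ico 0 T, ∀ x ∈ Ω, divergence (u t) x = 0
  no_slip : ∀ t ∈ Ico 0 T, ∀ x ∈ frontier Ω, u t x = 0
  initial : ∀ x ∈ closure Ω, u 0 x = u₀ x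

end LaminarFlow

end

/-! At `t = 0` the momentum equation reads `D_t u = ν Δu₀ - ∇p`. By no-slip both `u` and `∂_t u`
vanish on the boundary, so this force vanishes there too. The quotient in question is thus a `0/0`
limit at a boundary point, equal to the quotient of the derivatives along the inward normal `n`
(`IsSmoothDomain.tendsto_div`). The denominator contributes `h'(0) = α₁`.

The numerator requires knowing `u₀`. Poincaré maps that preserve the distance to the boundary force
`u₀` to be tangent to the parallel curves, and incompressibility then makes its tangential component
constant along each of them. Hence `u₀(Φ(s, r)) = h(r) τ(s)` with `τ = ∂_s φ`
(`IsParallelLaminar.velocity_eq`). Over the arc this is a rotation about a fixed centre, and its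
Laplacian is `(h'' + h'/(δ + r) - h/(δ + r)²) τ`, an explicit function of `r`
(`IsBoundaryCurve.laplacian_arc`).

The pressure is not explicit, but only `∂_n ∂_τ p` on the arc is needed. There `∇p = ν Δu₀ = m τ`
with `m = ν (α₁/δ - α₂)`. Differentiating along the arc gives `-(m/δ) n`, and symmetry of the second
derivative yields `∂_n ∂_τ p = -m/δ`. Together with `∂_n ⟨ν Δu₀, τ⟩ = -2ν α₁/δ² - ν α₂/δ`, the
numerator is `-2ν α₂/δ - ν α₁/δ²` (`IsBoundaryCurve.fderivWithin_forceClosure`). -/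

namespace LaminarFlow

/-! ### Rotation and orthonormal frames in the plane -/

section Plane

lemma inner_eq (x y : Plane) : ⟪x, y⟫ = x 0 * y 0 + x 1 * y 1 := by
  simp [PiLp.inner_apply, Fin.sum_univ_two, mul_comm]

@[simp] lemma perp_zero_coord (v : Plane) : perp v 0 = -v 1 := by simp [perp]

@[simp] lemma perp_one_coord (v : Plane) : perp v 1 = v 0 := by simp [perp]

lemma plane_ext {x y : Plane} (h0 : x 0 = y 0) (h1 : x 1 = y 1) : x = y := by
  ext i; fin_cases i <;> assumption

/-- Rotation by a right angle as a continuous linear map. -/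
noncomputable def perpL : Plane →L[ℝ] Plane :=
  LinearMap.toContinuousLinearMap
    { toFun := perp
      map_add' := fun x y => by apply plane_ext <;> simp; ring
      map_smul' := fun c x => by apply plane_ext <;> simp }

@[simp] lemma perpL_apply (v : Plane) : perpL v = perp v := rfl

lemma perp_smul (c : ℝ) (v : Plane) : perp (c • v) = c • perp v := perpL.map_smul c v

lemma perp_perp (v : Plane) : perp (perp v) = -v := by apply plane_ext <;> simp

lemma inner_perp_self (v : Plane) : ⟪perp v, v⟫ = 0 := by simp [inner_eq]; ring

lemma inner_self_perp (v : Plane) : ⟪v, perp v⟫ = 0 := by simp [inner_eq]; ring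

lemma norm_perp (v : Plane) : ‖perp v‖ = ‖v‖ := by
  simp [EuclideanSpace.norm_eq, Fin.sum_univ_two, add_comm]

lemma inner_perp_perp (v w : Plane) : ⟪perp v, perp w⟫ = ⟪v, w⟫ := by
  simp [inner_eq]; ring

lemma inner_self_of_norm_one {v : Plane} (hv : ‖v‖ = 1) : ⟪v, v⟫ = 1 := by
  rw [real_inner_self_eq_norm_sq, hv]; norm_num

/-- Coordinates in the orthonormal frame `v, perp v`. -/
lemma eq_frame {v : Plane} (hv : ‖v‖ = 1) (x : Plane) :
    x = ⟪x, v⟫ • v + ⟪x, perp v⟫ • perp v := by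
  have h := inner_self_of_norm_one hv
  rw [inner_eq] at h
  apply plane_ext <;> simp [inner_eq]
  · linear_combination -x 0 * h
  · linear_combination -x 1 * h

end Plane

/-! ### Frenet formulas and normal coordinates -/

section Curve

variable {Ω : Set Plane} {φ : ℝ → Plane} {s₀ s₂ δ : ℝ}

lemma IsBoundaryCurve.contDiff_deriv (hφ : IsBoundaryCurve Ω φ s₀ s₂ δ) :
    ContDiff ℝ ∞ (deriv φ) :=
  (contDiff_infty_iff_deriv.mp hφ.smooth).2

lemma IsBoundaryCurve.hasDerivAt (hφ : IsBoundaryCurve Ω φ s₀ s₂ δ) (s : ℝ) :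
    HasDerivAt φ (deriv φ s) s :=
  (hφ.smooth.differentiable (by simp) s).hasDerivAt

lemma IsBoundaryCurve.hasDerivAt_deriv_aux (hφ : IsBoundaryCurve Ω φ s₀ s₂ δ) (s : ℝ) :
    HasDerivAt (deriv φ) (deriv (deriv φ) s) s :=
  (hφ.contDiff_deriv.differentiable (by simp) s).hasDerivAt

lemma IsBoundaryCurve.inner_deriv_deriv (hφ : IsBoundaryCurve Ω φ s₀ s₂ δ) (s : ℝ) :
    ⟪deriv (deriv φ) s, deriv φ s⟫ = 0 := by
  have h := (hφ.hasDerivAt_deriv_aux s).inner ℝ (hφ.hasDerivAt_deriv_aux s)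
  have h1 : (fun t => ⟪deriv φ t, deriv φ t⟫) = fun _ => (1 : ℝ) := by
    funext t; exact inner_self_of_norm_one (hφ.unit_speed t)
  rw [h1] at h
  have h2 := h.unique (hasDerivAt_const s (1 : ℝ))
  rw [real_inner_comm (deriv (deriv φ) s)] at h2
  rw [real_inner_comm] at h2
  have h3 := real_inner_comm (deriv (deriv φ) s) (deriv φ s)
  linarith

/-- The component of `∂_s φ(t)` along the normal at `s` is `sin (θ t - θ s)`. It vanishes at `t = s`
and is nonpositive just to the right because `θ` does not increase. This fixes the sign in the
Frenet formula. -/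
lemma IsBoundaryCurve.inner_deriv_deriv_perp_nonpos (hφ : IsBoundaryCurve Ω φ s₀ s₂ δ) (s : ℝ) :
    ⟪deriv (deriv φ) s, perp (deriv φ s)⟫ ≤ 0 := by
  obtain ⟨θ, hθc, hθa, -, hθ⟩ := hφ.angle
  have h := ((hφ.hasDerivAt_deriv_aux s).inner ℝ
    (hasDerivAt_const s (perp (deriv φ s)))).hasDerivWithinAt (s := Ioi s)
  simp only [inner_zero_right, zero_add] at h
  have ht := (hasDerivWithinAt_iff_tendsto_slope' (by simp : s ∉ Ioi s)).1 h
  refine le_of_tendsto ht ?_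
  -- A drop of less than `1 < π` keeps the angle difference where the sine is nonpositive.
  have hev : ∀ᶠ t in 𝓝[>] s, θ s - 1 < θ t :=
    ((hθc.tendsto s).mono_left nhdsWithin_le_nhds).eventually (lt_mem_nhds (by linarith))
  filter_upwards [hev, self_mem_nhdsWithin] with t ht1 ht2
  have e : ∀ t, ⟪deriv φ t, perp (deriv φ s)⟫ = Real.sin (θ t - θ s) := by
    intro t
    rw [inner_eq, hθ t, hθ s, Real.sin_sub]; simp; ring
  rw [slope_def_field, e, e]
  have h1 : Real.sin (θ t - θ s) ≤ 0 :=
    Real.sin_nonpos_of_nonpos_of_neg_pi_le (by linarith [hθa (le_of_lt ht2)])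
      (by linarith [Real.pi_gt_three])
  have h2 : (0 : ℝ) < t - s := sub_pos.mpr ht2
  simp only [sub_self, Real.sin_zero, sub_zero]
  exact div_nonpos_of_nonpos_of_nonneg h1 h2.le

/-- The Frenet formula for the tangent. -/
lemma IsBoundaryCurve.deriv_deriv (hφ : IsBoundaryCurve Ω φ s₀ s₂ δ) (s : ℝ) :
    deriv (deriv φ) s = -(‖deriv (deriv φ) s‖ • perp (deriv φ s)) := by
  have h := eq_frame (hφ.unit_speed s) (deriv (deriv φ) s)
  rw [hφ.inner_deriv_deriv s, zero_smul, zero_add] at h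
  have h0 := hφ.inner_deriv_deriv_perp_nonpos s
  have h1 : ‖deriv (deriv φ) s‖ = -⟪deriv (deriv φ) s, perp (deriv φ s)⟫ := by
    conv_lhs => rw [h]
    rw [norm_smul, norm_perp, hφ.unit_speed, mul_one, Real.norm_of_nonpos h0]
  rw [h1, neg_smul, neg_neg]
  exact h

lemma IsBoundaryCurve.hasDerivAt_deriv (hφ : IsBoundaryCurve Ω φ s₀ s₂ δ) (s : ℝ) :
    HasDerivAt (deriv φ) (-(‖deriv (deriv φ) s‖ • perp (deriv φ s))) s := by
  rw [← hφ.deriv_deriv]; exact hφ.hasDerivAt_deriv_aux s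

lemma IsBoundaryCurve.hasDerivAt_perp (hφ : IsBoundaryCurve Ω φ s₀ s₂ δ) (s : ℝ) :
    HasDerivAt (fun s => perp (deriv φ s)) (‖deriv (deriv φ) s‖ • deriv φ s) s := by
  have h := perpL.hasFDerivAt.comp_hasDerivAt s (hφ.hasDerivAt_deriv s)
  refine h.congr_deriv ?_
  rw [map_neg, map_smul, perpL_apply, perp_perp]; simp

lemma IsBoundaryCurve.hasDerivAt_normalCoord (hφ : IsBoundaryCurve Ω φ s₀ s₂ δ) (s r : ℝ) :
    HasDerivAt (fun s => normalCoord φ s r) ((1 + r * ‖deriv (deriv φ) s‖) • deriv φ s) s := by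
  have h := (hφ.hasDerivAt s).add ((hφ.hasDerivAt_perp s).const_smul r)
  refine h.congr_deriv ?_
  rw [add_smul, one_smul, mul_smul]

lemma hasDerivAt_normalCoord_right (φ : ℝ → Plane) (s r : ℝ) :
    HasDerivAt (fun r => normalCoord φ s r) (perp (deriv φ s)) r := by
  have h := ((hasDerivAt_id r).smul_const (perp (deriv φ s))).const_add (φ s)
  exact h.congr_deriv (one_smul _ _)

lemma normalCoord_zero (φ : ℝ → Plane) (s : ℝ) : normalCoord φ s 0 = φ s := by
  simp [normalCoord]

lemma IsBoundaryCurve.deriv_start (hφ : IsBoundaryCurve Ω φ s₀ s₂ δ) :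
    deriv φ s₀ = !₂[1, 0] := by
  obtain ⟨θ, -, -, h0, hθ⟩ := hφ.angle
  rw [hθ, h0]; simp

lemma IsBoundaryCurve.normalCoord_start (hφ : IsBoundaryCurve Ω φ s₀ s₂ δ) (r : ℝ) :
    normalCoord φ s₀ r = !₂[0, r] := by
  rw [normalCoord, hφ.origin, hφ.deriv_start]
  apply plane_ext <;> simp

/-- On the circular arc, the curve is `δ • n` relative to its centre. -/
lemma IsBoundaryCurve.center_eq (hφ : IsBoundaryCurve Ω φ s₀ s₂ δ) {s : ℝ} (hs : s ∈ Icc 0 s₂) :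
    φ s - δ • perp (deriv φ s) = φ 0 - δ • perp (deriv φ 0) := by
  have hd : ∀ s, HasDerivAt (fun s => φ s - δ • perp (deriv φ s))
      (deriv φ s - δ • (‖deriv (deriv φ) s‖ • deriv φ s)) s := fun s =>
    (hφ.hasDerivAt s).sub ((hφ.hasDerivAt_perp s).const_smul δ)
  refine constant_of_has_deriv_right_zero (a := 0) (b := s₂)
    (fun s _ => (hd s).continuousAt.continuousWithinAt) (fun s hs => ?_) s hs
  convert (hd s).hasDerivWithinAt using 1
  rw [hφ.curvature_arc s ⟨hs.1, hs.2.le⟩, smul_smul, mul_one_div_cancel hφ.δ_pos.ne', one_smul,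
    sub_self]

end Curve

/-! ### From the Poincaré maps to tangency of the flow -/

section Tangency

variable {Ω : Set Plane} {φ : ℝ → Plane} {s₀ s₂ δ : ℝ}

/-- A streamline stays close to its tangent line as long as the direction field is almost
constant. -/
lemma IsStreamline.norm_sub_le {v : Plane → Plane} {γ : ℝ → Plane} {ℓ : ℝ}
    (hγ : IsStreamline Ω v γ ℓ) {η e : ℝ}
    (h : ∀ y, ‖y - γ 0‖ ≤ η → ‖‖v y‖⁻¹ • v y - ‖v (γ 0)‖⁻¹ • v (γ 0)‖ ≤ e)
    {t : ℝ} (ht : t ∈ Icc 0 ℓ) (htη : t ≤ η) :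
    ‖γ t - γ 0‖ ≤ t ∧ ‖γ t - γ 0 - t • ‖v (γ 0)‖⁻¹ • v (γ 0)‖ ≤ e * t := by
  have hunit : ∀ t ∈ Icc 0 ℓ, ‖‖v (γ t)‖⁻¹ • v (γ t)‖ ≤ 1 := fun t ht => by
    rw [norm_smul, norm_inv, norm_norm, inv_mul_cancel₀ (norm_ne_zero_iff.mpr (hγ t ht).2.1)]
  have h1 : ∀ t ∈ Icc 0 ℓ, ‖γ t - γ 0‖ ≤ t := fun t ht => by
    have := (convex_Icc 0 ℓ).norm_image_sub_le_of_norm_hasDerivWithin_le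
      (fun t ht => (hγ t ht).2.2) hunit (left_mem_Icc.mpr (ht.1.trans ht.2)) ht
    simpa [abs_of_nonneg ht.1] using this
  refine ⟨h1 t ht, ?_⟩
  set w := ‖v (γ 0)‖⁻¹ • v (γ 0)
  have hsub : Icc 0 t ⊆ Icc 0 ℓ := Icc_subset_Icc_right ht.2
  have := (convex_Icc 0 t).norm_image_sub_le_of_norm_hasDerivWithin_le
    (f := fun t => γ t - t • w) (f' := fun t => ‖v (γ t)‖⁻¹ • v (γ t) - w) (C := e)
    (fun τ hτ => by
      have h2 := ((hγ τ (hsub hτ)).2.2.mono hsub).sub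
        (((hasDerivAt_id τ).smul_const w).hasDerivWithinAt (s := Icc 0 t))
      rw [one_smul] at h2
      exact h2)
    (fun τ hτ => h _ ((h1 τ (hsub hτ)).trans (hτ.2.trans htη)))
    (left_mem_Icc.mpr ht.1) (right_mem_Icc.mpr ht.1)
  simp only [zero_smul, sub_zero, Real.norm_eq_abs, abs_of_nonneg ht.1] at this
  rwa [sub_right_comm] at this

lemma mem_normal_line {φ : ℝ → Plane} {s : ℝ} (hs : ‖deriv φ s‖ = 1) {x : Plane}
    (hx : ⟪x - φ s, deriv φ s⟫ = 0) :
    x = normalCoord φ s ⟪x - φ s, perp (deriv φ s)⟫ := by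
  have h := eq_frame hs (x - φ s)
  rw [hx, zero_smul, zero_add] at h
  rw [normalCoord, ← h]; abel

/-- If the Poincaré maps preserve the distance to the boundary, the field is tangent to the
parallel curves. -/
lemma IsBoundaryCurve.tangent_of_poincare (hφ : IsBoundaryCurve Ω φ s₀ s₂ δ)
    {v : Plane → Plane} {s r ε : ℝ} (hr : 0 < r) (hε : 0 < ε)
    (hv : ContinuousAt v (normalCoord φ s r)) (hv0 : v (normalCoord φ s r) ≠ 0)
    (hright : 0 < ⟪deriv φ s, ‖v (normalCoord φ s r)‖⁻¹ • v (normalCoord φ s r)⟫)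
    (hP : ∀ s₁ ∈ Ioo s (s + ε), IsPoincareValue Ω v φ s s₁ r r) :
    ⟪v (normalCoord φ s r), perp (deriv φ s)⟫ = 0 := by
  set x := normalCoord φ s r with hx
  set w := ‖v x‖⁻¹ • v x with hw
  set κ := ‖deriv (deriv φ) s‖ with hκ
  have hκ0 : 0 ≤ κ := norm_nonneg _
  set c := ⟪deriv φ s, w⟫ with hc
  have hwc : ContinuousAt (fun y => ‖v y‖⁻¹ • v y) x :=
    (hv.norm.inv₀ (norm_ne_zero_iff.mpr hv0)).smul hv
  suffices key : ∀ e > 0, |⟪w, perp (deriv φ s)⟫| ≤ 2 * e by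
    have h0 : ⟪w, perp (deriv φ s)⟫ = 0 := by
      by_contra hne
      have := key (|⟪w, perp (deriv φ s)⟫| / 4) (by positivity)
      have h2 : 0 < |⟪w, perp (deriv φ s)⟫| := abs_pos.mpr hne
      linarith
    rw [hw, real_inner_smul_left] at h0
    exact (mul_eq_zero.mp h0).resolve_left (inv_ne_zero (norm_ne_zero_iff.mpr hv0))
  intro e₀ he₀
  -- The cap `c / 4` is for the crossing argument in `hℓη`: the streamline advances by more than `c
  -- η / 2`, from which the direction error and the initial gap each remove at most `c η / 4`.
  set e := min e₀ (c / 4) with he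
  have hepos : 0 < e := lt_min he₀ (by positivity)
  obtain ⟨η, hη, hball⟩ : ∃ η > 0, ∀ y, ‖y - x‖ ≤ η → ‖‖v y‖⁻¹ • v y - w‖ ≤ e := by
    obtain ⟨η, hη, h⟩ := Metric.continuousAt_iff.mp hwc e hepos
    refine ⟨η / 2, by positivity, fun y hy => ?_⟩
    rw [← dist_eq_norm] at hy ⊢
    exact (h (by linarith)).le
  have hq : HasDerivAt (fun s₁ => ⟪x - φ s₁, deriv φ s₁⟫) (-(1 + r * κ)) s := by
    have h := ((hφ.hasDerivAt s).const_sub x).inner ℝ (hφ.hasDerivAt_deriv s)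
    refine h.congr_deriv ?_
    have : x - φ s = r • perp (deriv φ s) := by simp [hx, normalCoord]
    rw [this, inner_neg_left, inner_neg_right, inner_smul_left, inner_smul_right,
      inner_perp_perp, inner_self_of_norm_one (hφ.unit_speed s), ← hκ]
    simp only [conj_trivial]; ring
  have hq0 : ⟪x - φ s, deriv φ s⟫ = 0 := by
    have : x - φ s = r • perp (deriv φ s) := by simp [hx, normalCoord]
    rw [this, inner_smul_left, inner_perp_self, mul_zero]
  have ev1 : ∀ᶠ s₁ in 𝓝[>] s, ⟪x - φ s₁, deriv φ s₁⟫ < 0 := by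
    have ht := (hasDerivWithinAt_iff_tendsto_slope' (by simp : s ∉ Ioi s)).1
      (hq.hasDerivWithinAt (s := Ioi s))
    have : -(1 + r * κ) < 0 := by have := mul_nonneg hr.le hκ0; linarith
    filter_upwards [ht.eventually (gt_mem_nhds this), self_mem_nhdsWithin] with t h1 h2
    rw [slope_def_field, hq0, sub_zero] at h1
    have h2 : (0 : ℝ) < t - s := sub_pos.mpr h2
    by_contra h3
    exact absurd h1 (not_lt.mpr (div_nonneg (not_lt.mp h3) h2.le))
  have ev2 : ∀ᶠ s₁ in 𝓝[>] s, -(c * η / 4) < ⟪x - φ s₁, deriv φ s₁⟫ := by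
    have h := hq.continuousAt.tendsto.mono_left (nhdsWithin_le_nhds (s := Ioi s))
    rw [hq0] at h
    exact h.eventually (lt_mem_nhds (by have : 0 < c * η := by positivity
                                        linarith))
  have ev3 : ∀ᶠ s₁ in 𝓝[>] s, c / 2 < ⟪deriv φ s₁, w⟫ := by
    have h : ContinuousAt (fun s₁ => ⟪deriv φ s₁, w⟫) s :=
      (hφ.hasDerivAt_deriv s).continuousAt.inner continuousAt_const
    exact (h.tendsto.mono_left nhdsWithin_le_nhds).eventually
      (lt_mem_nhds (by show c / 2 < c; linarith))
  -- The chord between equidistant points of the two normal lines is tangent to the parallel curve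
  -- to first order.
  have ev4 : ∀ᶠ s₁ in 𝓝[>] s, |⟪normalCoord φ s₁ r - x, perp (deriv φ s)⟫| ≤
      e * ‖normalCoord φ s₁ r - x‖ := by
    have hd := hφ.hasDerivAt_normalCoord s r
    rw [← hκ] at hd
    set d := (1 + r * κ) • deriv φ s with hdd
    have hdn : 1 ≤ ‖d‖ := by
      have := mul_nonneg hr.le hκ0
      rw [hdd, norm_smul, hφ.unit_speed, mul_one, Real.norm_of_nonneg (by linarith)]
      linarith
    -- The bound `1 / 2` gives a chord of length at least `(t - s) / 2`; the bound `e / 2` then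
    -- makes its normal part at most `e` times that length.
    have hm : 0 < min (1 / 2) (e / 2) := by positivity
    have hlo := (hasDerivAt_iff_isLittleO.mp hd).def hm
    filter_upwards [nhdsWithin_le_nhds hlo, self_mem_nhdsWithin] with t h1 h2
    have h2 : (0 : ℝ) < t - s := sub_pos.mpr h2
    rw [Real.norm_of_nonneg h2.le] at h1
    set Y := normalCoord φ t r - x with hY
    have hn1 : (t - s) ≤ ‖(t - s) • d‖ := by
      rw [norm_smul, Real.norm_of_nonneg h2.le]; nlinarith
    have hn2 : ‖(t - s) • d‖ ≤ ‖Y‖ + ‖Y - (t - s) • d‖ := by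
      have := norm_sub_le Y (Y - (t - s) • d)
      rwa [sub_sub_cancel] at this
    have hn3 : (t - s) / 2 ≤ ‖Y‖ := by
      have := mul_le_mul_of_nonneg_right (min_le_left (1 / 2) (e / 2)) h2.le
      linarith
    have hdp : ⟪(t - s) • d, perp (deriv φ s)⟫ = 0 := by
      rw [hdd, smul_smul, inner_smul_left, inner_self_perp, mul_zero]
    have hYp : ⟪Y, perp (deriv φ s)⟫ = ⟪Y - (t - s) • d, perp (deriv φ s)⟫ := by
      rw [inner_sub_left Y, hdp, sub_zero]
    rw [hYp]
    refine (abs_real_inner_le_norm _ _).trans ?_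
    rw [norm_perp, hφ.unit_speed, mul_one]
    have := mul_le_mul_of_nonneg_right (min_le_right (1 / 2) (e / 2)) h2.le
    nlinarith
  have ev5 : ∀ᶠ s₁ in 𝓝[>] s, s₁ ∈ Ioo s (s + ε) := Ioo_mem_nhdsGT (by linarith)
  obtain ⟨s₁, h1, h2, h3, h4, h5⟩ := (ev1.and (ev2.and (ev3.and (ev4.and ev5)))).exists
  obtain ⟨ℓ, hℓ, γ, hγ, hγ0, hγℓ, hfirst⟩ := hP s₁ h5
  rw [← hx] at hγ0
  have hbound := fun t ht htη => hγ.norm_sub_le (η := η) (e := e) (t := t)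
    (by rw [hγ0]; exact hball) ht htη
  simp only [hγ0, ← hw] at hbound
  have hcont : ContinuousOn γ (Icc 0 ℓ) := fun t ht => (hγ t ht).2.2.continuousWithinAt
  -- Otherwise the streamline lies behind the normal line at time `0` and beyond it at time `η < ℓ`,
  -- so it crosses strictly before its first meeting.
  have hℓη : ℓ ≤ η := by
    by_contra hlt
    push Not at hlt
    have hb := (hbound η ⟨hη.le, hlt.le⟩ le_rfl).2
    have hpos : 0 < ⟪γ η - φ s₁, deriv φ s₁⟫ := by
      have e1 : γ η - φ s₁ = (γ η - x - η • w) + η • w + (x - φ s₁) := by abel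
      rw [e1, inner_add_left, inner_add_left, inner_smul_left]
      have e2 := neg_le_of_abs_le (abs_real_inner_le_norm (γ η - x - η • w) (deriv φ s₁))
      rw [hφ.unit_speed, mul_one] at e2
      rw [real_inner_comm] at h3
      have e3 : e * η ≤ c / 4 * η := mul_le_mul_of_nonneg_right (min_le_right _ _) hη.le
      have e4 : c / 2 * η < ⟪w, deriv φ s₁⟫ * η := mul_lt_mul_of_pos_right h3 hη
      simp only [conj_trivial]
      nlinarith
    have hivt := intermediate_value_Ioo (f := fun t => ⟪γ t - φ s₁, deriv φ s₁⟫) hη.le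
      (((hcont.mono (Icc_subset_Icc_right hlt.le)).sub continuousOn_const).inner
        continuousOn_const)
    have h0 : (0 : ℝ) ∈ Ioo ⟪γ 0 - φ s₁, deriv φ s₁⟫ ⟪γ η - φ s₁, deriv φ s₁⟫ :=
      ⟨by rw [hγ0]; exact h1, hpos⟩
    obtain ⟨t, ht, ht0⟩ := hivt h0
    exact hfirst t ⟨ht.1, ht.2.trans hlt⟩ _ (mem_normal_line (hφ.unit_speed s₁) ht0)
  obtain ⟨hb1, hb2⟩ := hbound ℓ ⟨hℓ.le, le_rfl⟩ hℓη
  rw [hγℓ] at hb1 hb2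
  -- The displacement `ℓ w` is the chord minus the deviation from the tangent line; both have normal
  -- part at most `e ℓ`.
  have e1 : ℓ * ⟪w, perp (deriv φ s)⟫ = ⟪normalCoord φ s₁ r - x, perp (deriv φ s)⟫ -
      ⟪normalCoord φ s₁ r - x - ℓ • w, perp (deriv φ s)⟫ := by
    rw [inner_sub_left (_ - _) (ℓ • w), inner_smul_left w]; simp only [conj_trivial]; ring
  have e2 := abs_real_inner_le_norm (normalCoord φ s₁ r - x - ℓ • w) (perp (deriv φ s))
  rw [norm_perp, hφ.unit_speed, mul_one] at e2
  have e3 : |ℓ * ⟪w, perp (deriv φ s)⟫| ≤ 2 * e * ℓ := by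
    rw [e1]
    refine (abs_sub _ _).trans ?_
    have := mul_le_mul_of_nonneg_left hb1 hepos.le
    linarith
  rw [abs_mul, abs_of_pos hℓ, mul_comm] at e3
  have := le_of_mul_le_mul_right e3 hℓ
  linarith [min_le_left e₀ (c / 4)]

end Tangency

/-! ### Transport of the velocity profile along the parallel curves -/

section Sector

variable {Ω : Set Plane} {φ : ℝ → Plane} {s₀ s₂ δ : ℝ}

/-- The divergence is the trace in any orthonormal frame. -/
lemma divergence_eq_frame (v : Plane → Plane) (x : Plane) {τ : Plane} (hτ : ‖τ‖ = 1) :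
    divergence v x = ⟪fderiv ℝ v x τ, τ⟫ + ⟪fderiv ℝ v x (perp τ), perp τ⟫ := by
  have h := inner_self_of_norm_one hτ
  rw [inner_eq] at h
  have e : ∀ w : Plane, w = w 0 • EuclideanSpace.single (0 : Fin 2) (1 : ℝ) +
      w 1 • EuclideanSpace.single (1 : Fin 2) (1 : ℝ) := fun w => by
    apply plane_ext <;> simp
  rw [divergence, Fin.sum_univ_two]
  conv_rhs => rw [e τ, e (perp _)]
  simp only [map_add, map_smul, inner_eq, PiLp.add_apply, PiLp.smul_apply, smul_eq_mul,
    perp_zero_coord, perp_one_coord]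
  simp
  generalize (fderiv ℝ v x) (EuclideanSpace.single (0 : Fin 2) (1 : ℝ)) = a
  generalize (fderiv ℝ v x) (EuclideanSpace.single (1 : Fin 2) (1 : ℝ)) = b
  linear_combination (-(a 0) - b 1) * h

/-- A parallel laminar flow transports its profile along the parallel curves. -/
theorem IsParallelLaminar.velocity_eq (hφ : IsBoundaryCurve Ω φ s₀ s₂ δ) (hΩ : IsOpen Ω)
    {v : Plane → Plane} (hv : DifferentiableOn ℝ v Ω) (hdiv : ∀ x ∈ Ω, divergence v x = 0)
    (hlam : IsParallelLaminar Ω v φ s₀ s₂) {h : ℝ → ℝ}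
    (hprofile : ∃ ρ > 0, ∀ r ∈ Ioo 0 ρ, v !₂[0, r] = !₂[h r, 0]) :
    ∃ ρ > 0, ∀ s ∈ Icc s₀ s₂, ∀ r ∈ Ioo 0 ρ,
      normalCoord φ s r ∈ Ω ∧ v (normalCoord φ s r) = h r • deriv φ s := by
  obtain ⟨ρ₁, hρ₁, hin⟩ := hφ.interior_side
  obtain ⟨ρ₂, hρ₂, hright⟩ := hlam.rightward
  obtain ⟨ρ₃, hρ₃, ε, hε, hpar⟩ := hlam.parallel
  obtain ⟨ρ₄, hρ₄, hprof⟩ := hprofile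
  set ρ := min (min ρ₁ ρ₂) (min ρ₃ ρ₄) with hρ
  have l1 : ρ ≤ ρ₁ := (min_le_left _ _).trans (min_le_left _ _)
  have l2 : ρ ≤ ρ₂ := (min_le_left _ _).trans (min_le_right _ _)
  have l3 : ρ ≤ ρ₃ := (min_le_right _ _).trans (min_le_left _ _)
  have l4 : ρ ≤ ρ₄ := (min_le_right _ _).trans (min_le_right _ _)
  have hmem : ∀ s ∈ Icc s₀ s₂, ∀ r ∈ Ioo 0 ρ, normalCoord φ s r ∈ Ω := fun s hs r hr =>
    hin s hs r ⟨hr.1, hr.2.trans_le l1⟩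
  have hdv : ∀ s ∈ Icc s₀ s₂, ∀ r ∈ Ioo 0 ρ, HasFDerivAt v (fderiv ℝ v (normalCoord φ s r))
      (normalCoord φ s r) := fun s hs r hr =>
    (hv.differentiableAt (hΩ.mem_nhds (hmem s hs r hr))).hasFDerivAt
  -- Tangency needs normal lines further along the curve, hence the half-open interval; `hn`
  -- recovers the endpoint `s₂` by continuity.
  have htan : ∀ s ∈ Ico s₀ s₂, ∀ r ∈ Ioo 0 ρ,
      ⟪v (normalCoord φ s r), perp (deriv φ s)⟫ = 0 := fun s hs r hr => by
    have hs' := Ico_subset_Icc_self hs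
    obtain ⟨h0, h1⟩ := hright s hs' r ⟨hr.1, hr.2.trans_le l2⟩
    refine hφ.tangent_of_poincare (ε := min ε (s₂ - s)) hr.1 (lt_min hε (sub_pos.mpr hs.2))
      (hdv s hs' r hr).continuousAt h0 h1 fun s₁ hs₁ => ?_
    have b1 := min_le_left ε (s₂ - s)
    have b2 := min_le_right ε (s₂ - s)
    obtain ⟨τ, hτ, hτr⟩ := hpar s hs' s₁ ⟨hs.1.trans hs₁.1.le, by linarith [hs₁.2]⟩ hs₁.1
      (by linarith [hs₁.2]) r ⟨hr.1, hr.2.trans_le l3⟩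
    rw [div_eq_one_iff_eq hr.1.ne'] at hτr
    rwa [hτr] at hτ
  have hΦ : ∀ s ∈ Icc s₀ s₂, ∀ r ∈ Ioo 0 ρ, HasDerivAt (fun s => v (normalCoord φ s r))
      (fderiv ℝ v (normalCoord φ s r) ((1 + r * ‖deriv (deriv φ) s‖) • deriv φ s)) s :=
    fun s hs r hr => (hdv s hs r hr).comp_hasDerivAt s (hφ.hasDerivAt_normalCoord s r)
  refine ⟨ρ, by positivity, fun s hs r hr => ⟨hmem s hs r hr, ?_⟩⟩
  have hn : EqOn (fun s => ⟪v (normalCoord φ s r), perp (deriv φ s)⟫) (fun _ => 0)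
      (Icc s₀ s₂) := by
    refine EqOn.of_subset_closure (s := Ico s₀ s₂) (fun s hs => htan s hs r hr) ?_
      continuousOn_const Ico_subset_Icc_self ?_
    · intro s hs
      exact ((hΦ s hs r hr).continuousAt.inner
        (hφ.hasDerivAt_perp s).continuousAt).continuousWithinAt
    · rw [closure_Ico (hφ.s₀_neg.trans hφ.s₂_pos).ne]
  -- The derivative in `s` is `(1 + r κ) ⟨∂_τ v, τ⟩ - κ ⟨v, n⟩`. The last term vanishes by tangency.
  -- Tangency for all nearby `r` also gives `⟨∂_n v, n⟩ = 0`, so zero divergence leaves `⟨∂_τ v, τ⟩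
  -- = 0`.
  have ha : ∀ s ∈ Icc s₀ s₂, ⟪v (normalCoord φ s r), deriv φ s⟫ =
      ⟪v (normalCoord φ s₀ r), deriv φ s₀⟫ := by
    have hd := fun s hs => (hΦ s hs r hr).inner ℝ (hφ.hasDerivAt_deriv s)
    refine constant_of_has_deriv_right_zero
      (fun s hs => (hd s hs).continuousAt.continuousWithinAt) fun s hs => ?_
    have hs' := Ico_subset_Icc_self hs
    refine ((hd s hs').congr_deriv ?_).hasDerivWithinAt
    have hnn : ⟪fderiv ℝ v (normalCoord φ s r) (perp (deriv φ s)), perp (deriv φ s)⟫ = 0 := by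
      have h1 := ((hdv s hs' r hr).comp_hasDerivAt r (hasDerivAt_normalCoord_right φ s r)).inner ℝ
        (hasDerivAt_const r (perp (deriv φ s)))
      have h2 : (fun t => ⟪(v ∘ fun r => normalCoord φ s r) t, perp (deriv φ s)⟫)
          =ᶠ[𝓝 r] fun _ => (0 : ℝ) := by
        filter_upwards [isOpen_Ioo.mem_nhds hr] with t ht using htan s hs t ht
      have h3 := h1.unique ((hasDerivAt_const r (0 : ℝ)).congr_of_eventuallyEq h2)
      simpa using h3
    have hd0 := hdiv _ (hmem s hs' r hr)
    rw [divergence_eq_frame v _ (hφ.unit_speed s), hnn, add_zero] at hd0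
    rw [map_smul, inner_smul_left, hd0, inner_neg_right, inner_smul_right, htan s hs r hr]
    simp
  have hfr := eq_frame (hφ.unit_speed s) (v (normalCoord φ s r))
  have hn' : ⟪v (normalCoord φ s r), perp (deriv φ s)⟫ = 0 := hn hs
  rw [hn', zero_smul, add_zero, ha s hs, hφ.normalCoord_start,
    hprof r ⟨hr.1, hr.2.trans_le l4⟩, hφ.deriv_start] at hfr
  simpa [inner_eq] using hfr

end Sector

/-! ### Smooth boundary points and L'Hôpital's rule -/

section Boundary

variable {Ω : Set Plane}

/-- Directions along which a defining function increases are inward directions. -/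
lemma eventually_mem_of_fderiv_pos {U : Set Plane} {g : Plane → ℝ} {x₀ w : Plane} (hU : IsOpen U)
    (hx : x₀ ∈ U) (hg : DifferentiableAt ℝ g x₀) (hg0 : g x₀ = 0) (hΩ : Ω ∩ U = {y ∈ U | 0 < g y})
    (hw : 0 < fderiv ℝ g x₀ w) :
    (∀ᶠ t in 𝓝[>] (0 : ℝ), x₀ + t • w ∈ Ω) ∧
    ∀ᶠ t in 𝓝[>] (0 : ℝ), x₀ - t • w ∈ U ∧ g (x₀ - t • w) < 0 := by
  have hline : ∀ z : Plane, HasDerivAt (fun t : ℝ => x₀ + t • z) z 0 := fun z =>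
    (((hasDerivAt_id (0 : ℝ)).smul_const z).const_add x₀).congr_deriv (one_smul _ _)
  have hx0 : ∀ z : Plane, x₀ + (0 : ℝ) • z = x₀ := by simp
  have hUe : ∀ z : Plane, ∀ᶠ t in 𝓝[>] (0 : ℝ), x₀ + t • z ∈ U := fun z =>
    ((hline z).continuousAt.tendsto.mono_left nhdsWithin_le_nhds).eventually
      (hU.mem_nhds (by rwa [hx0]))
  have hsl : ∀ z : Plane, Tendsto (slope (fun t : ℝ => g (x₀ + t • z)) 0) (𝓝[>] 0)
      (𝓝 (fderiv ℝ g x₀ z)) := fun z => by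
    have h1 : HasFDerivAt g (fderiv ℝ g x₀) (x₀ + (0 : ℝ) • z) := by
      rw [hx0]; exact hg.hasFDerivAt
    have h2 := h1.comp_hasDerivAt 0 (hline z)
    exact (hasDerivWithinAt_iff_tendsto_slope' (by simp)).1 (h2.hasDerivWithinAt (s := Ioi 0))
  constructor
  · filter_upwards [(hsl w).eventually (lt_mem_nhds hw), hUe w, self_mem_nhdsWithin]
      with t h1 h2 h3
    rw [slope_def_field, hx0, hg0, sub_zero, sub_zero] at h1
    have : x₀ + t • w ∈ Ω ∩ U := by
      rw [hΩ]; exact ⟨h2, (div_pos_iff_of_pos_right h3).mp h1⟩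
    exact this.1
  · have h4 : fderiv ℝ g x₀ (-w) < 0 := by rw [map_neg]; linarith
    filter_upwards [(hsl (-w)).eventually (gt_mem_nhds h4), hUe (-w), self_mem_nhdsWithin]
      with t h1 h2 h3
    rw [slope_def_field, hx0, hg0, sub_zero, sub_zero] at h1
    rw [smul_neg, ← sub_eq_add_neg] at h1 h2
    refine ⟨h2, not_le.mp fun h5 => ?_⟩
    exact absurd h1 (not_lt.mpr (div_nonneg h5 (le_of_lt h3)))

/-- At a boundary point the tangent cone contains the open half-plane where the differential of a
defining function is positive. It is nonempty since that differential is nonzero, so the cone spans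
the plane. -/
lemma IsSmoothDomain.uniqueDiffOn_closure (hΩ : IsSmoothDomain Ω) :
    UniqueDiffOn ℝ (closure Ω) := by
  intro x hx
  by_cases hxΩ : x ∈ Ω
  · exact (hΩ.isOpen.uniqueDiffWithinAt hxΩ).mono subset_closure
  have hfr : x ∈ frontier Ω := by rw [hΩ.isOpen.frontier_eq]; exact ⟨hx, hxΩ⟩
  obtain ⟨U, hU, hxU, g, hg, hg0, hdg, heq⟩ := hΩ.smooth_boundary x hfr
  have hgd : DifferentiableAt ℝ g x :=
    (hg.differentiableOn (by simp)).differentiableAt (hU.mem_nhds hxU)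
  set ℓ := fderiv ℝ g x
  have hsub : {w | 0 < ℓ w} ⊆ tangentConeAt ℝ (closure Ω) x := by
    intro w hw
    have hev := (eventually_mem_of_fderiv_pos hU hxU hgd hg0 heq hw).1
    exact mem_tangentConeAt_of_add_smul_mem (l := 𝓝[>] (0 : ℝ)) (c := id)
      (tendsto_id'.mpr (nhdsGT_le_nhdsNE 0)) (hev.mono fun t ht => subset_closure ht)
  have hopen : IsOpen {w | 0 < ℓ w} := isOpen_lt continuous_const ℓ.continuous
  obtain ⟨w₀, hw₀⟩ : ∃ w, 0 < ℓ w := by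
    by_contra hcon
    push Not at hcon
    refine hdg x hxU (ContinuousLinearMap.ext fun w => le_antisymm (hcon w) ?_)
    have := hcon (-w)
    rw [map_neg] at this
    simpa using this
  refine ⟨?_, subset_closure hx⟩
  have hspan : Submodule.span ℝ (tangentConeAt ℝ (closure Ω) x) = ⊤ := by
    refine Submodule.eq_top_of_nonempty_interior' _ ⟨w₀, ?_⟩
    exact interior_mono (hsub.trans Submodule.subset_span) (hopen.interior_eq.symm ▸ hw₀)
  rw [hspan]
  simp

/-- Below a point of `Ω` near the boundary point `x₀`, in a transversal direction, there is a
boundary point. -/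
lemma eventually_exists_frontier (hopen : IsOpen Ω) {U : Set Plane} {g : Plane → ℝ} {x₀ w : Plane}
    (hU : IsOpen U) (hx : x₀ ∈ U) (hgc : ContinuousOn g U) (hg : DifferentiableAt ℝ g x₀)
    (hg0 : g x₀ = 0) (hΩ : Ω ∩ U = {y ∈ U | 0 < g y}) (hw : 0 < fderiv ℝ g x₀ w)
    {R : ℝ} (hR : 0 < R) :
    ∀ᶠ x in 𝓝[Ω] x₀, ∃ t ∈ Ioo 0 R, x - t • w ∈ frontier Ω ∧ ∀ t' ∈ Ico 0 t, x - t' • w ∈ Ω := by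
  obtain ⟨T, ⟨hTU, hTg⟩, hT⟩ := ((eventually_mem_of_fderiv_pos hU hx hg hg0 hΩ hw).2.and
    (Ioo_mem_nhdsGT hR)).exists
  have hnear : ∀ᶠ x in 𝓝 x₀, x - T • w ∉ Ω := by
    have hc : ContinuousAt (fun x => x - T • w) x₀ := by fun_prop
    have h1 : ∀ᶠ y in 𝓝 (x₀ - T • w), y ∈ U ∧ g y < 0 :=
      (eventually_mem_set.mpr (hU.mem_nhds hTU)).and
        ((hgc.continuousAt (hU.mem_nhds hTU)).eventually (gt_mem_nhds hTg))
    filter_upwards [hc.eventually h1] with x hx hxΩ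
    have : x - T • w ∈ Ω ∩ U := ⟨hxΩ, hx.1⟩
    rw [hΩ] at this
    exact absurd this.2 (not_lt.mpr hx.2.le)
  filter_upwards [nhdsWithin_le_nhds hnear, self_mem_nhdsWithin] with x hxT hxΩ
  have hcont : Continuous fun t : ℝ => x - t • w := by fun_prop
  have hK : IsCompact (Icc 0 T ∩ (fun t : ℝ => x - t • w) ⁻¹' Ωᶜ) :=
    isCompact_Icc.inter_right (hopen.isClosed_compl.preimage hcont)
  -- The first exit time from `Ω` along the segment; its endpoint is the required boundary point.
  obtain ⟨t, ⟨htI, htΩ⟩, hmin⟩ := hK.exists_isLeast ⟨T, ⟨hT.1.le, le_rfl⟩, hxT⟩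
  have ht0 : 0 < t := by
    refine htI.1.lt_of_ne fun h => htΩ ?_
    rw [← h]; simpa using hxΩ
  have hin : ∀ t' ∈ Ico 0 t, x - t' • w ∈ Ω := fun t' ht' => by
    by_contra hcon
    exact absurd (hmin ⟨⟨ht'.1, ht'.2.le.trans htI.2⟩, hcon⟩) (not_le.mpr ht'.2)
  refine ⟨t, ⟨ht0, htI.2.trans_lt hT.2⟩, ?_, hin⟩
  rw [hopen.frontier_eq]
  refine ⟨?_, htΩ⟩
  have h1 : t ∈ closure (Ico 0 t) := by rw [closure_Ico ht0.ne]; exact ⟨ht0.le, le_rfl⟩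
  exact map_mem_closure (f := fun t : ℝ => x - t • w) hcont h1 hin

/-- L'Hôpital's rule at a smooth boundary point. -/
theorem IsSmoothDomain.tendsto_div (hΩ : IsSmoothDomain Ω) {F G : Plane → ℝ}
    (hF : ContDiffOn ℝ 1 F (closure Ω)) (hG : ContDiffOn ℝ 1 G (closure Ω))
    (hF0 : ∀ x ∈ frontier Ω, F x = 0) (hG0 : ∀ x ∈ frontier Ω, G x = 0)
    {x₀ w : Plane} (hx₀ : x₀ ∈ frontier Ω)
    {U : Set Plane} {g : Plane → ℝ} (hU : IsOpen U) (hx : x₀ ∈ U) (hgc : ContinuousOn g U)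
    (hg : DifferentiableAt ℝ g x₀) (hg0 : g x₀ = 0) (hgΩ : Ω ∩ U = {y ∈ U | 0 < g y})
    (hw : 0 < fderiv ℝ g x₀ w)
    (hGw : fderivWithin ℝ G (closure Ω) x₀ w ≠ 0) :
    Tendsto (fun x => F x / G x) (𝓝[Ω] x₀)
      (𝓝 (fderivWithin ℝ F (closure Ω) x₀ w / fderivWithin ℝ G (closure Ω) x₀ w)) := by
  have hud := hΩ.uniqueDiffOn_closure
  have hxK : x₀ ∈ closure Ω := frontier_subset_closure hx₀
  have hcF : Tendsto (fun x => fderivWithin ℝ F (closure Ω) x w) (𝓝[Ω] x₀)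
      (𝓝 (fderivWithin ℝ F (closure Ω) x₀ w)) :=
    (((hF.continuousOn_fderivWithin hud le_rfl).clm_apply continuousOn_const) x₀ hxK).mono_left
      (nhdsWithin_mono _ subset_closure)
  have hcG : Tendsto (fun x => fderivWithin ℝ G (closure Ω) x w) (𝓝[Ω] x₀)
      (𝓝 (fderivWithin ℝ G (closure Ω) x₀ w)) :=
    (((hG.continuousOn_fderivWithin hud le_rfl).clm_apply continuousOn_const) x₀ hxK).mono_left
      (nhdsWithin_mono _ subset_closure)
  have hder : ∀ H : Plane → ℝ, ContDiffOn ℝ 1 H (closure Ω) → ∀ (x : Plane) (t : ℝ),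
      x - t • w ∈ Ω → HasDerivAt (fun t : ℝ => H (x - t • w))
        (-(fderivWithin ℝ H (closure Ω) (x - t • w) w)) t := fun H hH x t ht => by
    have hnh : closure Ω ∈ 𝓝 (x - t • w) :=
      mem_of_superset (hΩ.isOpen.mem_nhds ht) subset_closure
    have h1 := ((hH.differentiableOn one_ne_zero _ (subset_closure ht)).hasFDerivWithinAt).hasFDerivAt
      hnh
    have h2 : HasDerivAt (fun t : ℝ => x - t • w) (-w) t :=
      (((hasDerivAt_id t).smul_const w).const_sub x).congr_deriv (by rw [one_smul])
    exact (h1.comp_hasDerivAt t h2).congr_deriv (map_neg _ _)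
  rw [tendsto_iff_forall_eventually_mem]
  intro N hN
  have hq : ∀ᶠ x in 𝓝[Ω] x₀, fderivWithin ℝ G (closure Ω) x w ≠ 0 ∧
      fderivWithin ℝ F (closure Ω) x w / fderivWithin ℝ G (closure Ω) x w ∈ N :=
    (hcG.eventually_ne hGw).and ((hcF.div hcG hGw).eventually hN)
  obtain ⟨e, he, hball⟩ := Metric.mem_nhdsWithin_iff.mp hq
  obtain ⟨R, hR, hRw⟩ : ∃ R : ℝ, 0 < R ∧ ∀ t ∈ Ioo 0 R, ‖t • w‖ < e / 2 := by
    refine ⟨e / 2 / (‖w‖ + 1), by positivity, fun t ht => ?_⟩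
    rw [norm_smul, Real.norm_of_nonneg ht.1.le]
    have := (lt_div_iff₀ (by positivity)).mp ht.2
    nlinarith [ht.1]
  filter_upwards [eventually_exists_frontier hΩ.isOpen hU hx hgc hg hg0 hgΩ hw hR,
    nhdsWithin_le_nhds (Metric.ball_mem_nhds x₀ (half_pos he)), self_mem_nhdsWithin]
    with x ⟨T, hT, hTfr, hTin⟩ hxb hxΩ
  have hseg : ∀ t ∈ Ioo 0 T, x - t • w ∈ Metric.ball x₀ e ∩ Ω := fun t ht => by
    refine ⟨?_, hTin t ⟨ht.1.le, ht.2⟩⟩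
    have h1 := hRw t ⟨ht.1, ht.2.trans hT.2⟩
    rw [Metric.mem_ball, dist_eq_norm] at hxb ⊢
    calc ‖x - t • w - x₀‖ = ‖(x - x₀) - t • w‖ := by congr 1; abel
      _ ≤ ‖x - x₀‖ + ‖t • w‖ := norm_sub_le _ _
      _ < e := by linarith
  have hcon : ∀ H : Plane → ℝ, ContDiffOn ℝ 1 H (closure Ω) →
      ContinuousOn (fun t : ℝ => H (x - t • w)) (Icc 0 T) := fun H hH => by
    refine hH.continuousOn.comp (by fun_prop) fun t ht => ?_
    rcases ht.2.lt_or_eq with h | h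
    · exact subset_closure (hTin t ⟨ht.1, h⟩)
    · rw [h]; exact frontier_subset_closure hTfr
  -- On the segment from `x` down to the boundary, the mean value theorem gives `G x ≠ 0`, and
  -- Cauchy's version writes `F x / G x` as a quotient of derivatives at a point close to `x₀`.
  obtain ⟨t, ht, htG⟩ := exists_hasDerivAt_eq_slope (fun t : ℝ => G (x - t • w)) _ hT.1 (hcon G hG)
    (fun t ht => hder G hG x t (hseg t ht).2)
  obtain ⟨t', ht', hcau⟩ := exists_ratio_hasDerivAt_eq_ratio_slope (fun t : ℝ => F (x - t • w)) _ hT.1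
    (hcon F hF) (fun t ht => hder F hF x t (hseg t ht).2) (fun t : ℝ => G (x - t • w)) _ (hcon G hG)
    (fun t ht => hder G hG x t (hseg t ht).2)
  simp only [hF0 _ hTfr, hG0 _ hTfr, zero_smul, sub_zero, zero_sub] at htG hcau
  have hGx : G x ≠ 0 := by
    intro h0
    rw [h0, neg_zero, zero_div, neg_eq_zero] at htG
    exact (hball (hseg t ht)).1 htG
  have hmem := hball (hseg t' ht')
  have : F x / G x = fderivWithin ℝ F (closure Ω) (x - t' • w) w /
      fderivWithin ℝ G (closure Ω) (x - t' • w) w := by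
    rw [div_eq_div_iff hGx hmem.1]
    linarith
  rw [this]
  exact hmem.2

end Boundary

/-! ### The Laplacian of a rotating field -/

section Laplacian

/-- The second directional derivative, computed along lines. -/
lemma fderiv_fderiv_apply_eq {E F : Type*} [NormedAddCommGroup E] [NormedSpace ℝ E]
    [NormedAddCommGroup F] [NormedSpace ℝ F] {f g₁ : E → F} {g₂ : F} {x b : E}
    (hf : ContDiffAt ℝ 2 f x)
    (h₁ : ∀ᶠ z in 𝓝 x, HasDerivAt (fun t : ℝ => f (z + t • b)) (g₁ z) 0)
    (h₂ : HasDerivAt (fun t : ℝ => g₁ (x + t • b)) g₂ 0) :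
    fderiv ℝ (fderiv ℝ f) x b b = g₂ := by
  have hline : ∀ z : E, HasDerivAt (fun t : ℝ => z + t • b) b 0 := fun z =>
    (((hasDerivAt_id (0 : ℝ)).smul_const b).const_add z).congr_deriv (one_smul _ _)
  have hz : ∀ z : E, z + (0 : ℝ) • b = z := by simp
  have hd : ∀ᶠ z in 𝓝 x, DifferentiableAt ℝ f z := by
    filter_upwards [hf.eventually (by simp)] with z hz using hz.differentiableAt (by simp)
  have heq : ∀ᶠ z in 𝓝 x, fderiv ℝ f z b = g₁ z := by
    filter_upwards [hd, h₁] with z hz1 hz2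
    have h : HasFDerivAt f (fderiv ℝ f z) (z + (0 : ℝ) • b) := by rw [hz]; exact hz1.hasFDerivAt
    exact (h.comp_hasDerivAt 0 (hline z)).unique hz2
  have hdd : HasFDerivAt (fderiv ℝ f) (fderiv ℝ (fderiv ℝ f) x) x :=
    ((hf.fderiv_right (m := 1) (by norm_num)).differentiableAt one_ne_zero).hasFDerivAt
  have hline0 : HasDerivAt (fun t : ℝ => fderiv ℝ f (x + t • b))
      (fderiv ℝ (fderiv ℝ f) x b) 0 :=
    hdd.comp_hasDerivAt_of_eq 0 (hline x) (hz x).symm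
  have h3 : HasDerivAt (fun t : ℝ => fderiv ℝ f (x + t • b) b)
      (fderiv ℝ (fderiv ℝ f) x b b) 0 :=
    (ContinuousLinearMap.apply ℝ F b).hasFDerivAt.comp_hasDerivAt 0 hline0
  have hev : (fun t : ℝ => fderiv ℝ f (x + t • b) b) =ᶠ[𝓝 0] fun t => g₁ (x + t • b) := by
    have hc : Tendsto (fun t : ℝ => x + t • b) (𝓝 0) (𝓝 x) := by
      have h := (hline x).continuousAt.tendsto
      rwa [hz] at h
    exact hc.eventually heq
  exact h3.unique (h₂.congr_of_eventuallyEq hev)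

lemma laplacian_eq_sum (f : Plane → Plane) (x : Plane) :
    Laplacian.laplacian f x = ∑ i : Fin 2, fderiv ℝ (fderiv ℝ f) x
      (EuclideanSpace.basisFun (Fin 2) ℝ i) (EuclideanSpace.basisFun (Fin 2) ℝ i) := by
  rw [InnerProductSpace.laplacian_eq_iteratedFDeriv_orthonormalBasis f
    (EuclideanSpace.basisFun (Fin 2) ℝ)]
  simp [iteratedFDeriv_two_apply]

lemma hasDerivAt_norm_line {y : Plane} (hy : y ≠ 0) (b : Plane) :
    HasDerivAt (fun t : ℝ => ‖y + t • b‖) (⟪y, b⟫ / ‖y‖) 0 := by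
  have hline : HasDerivAt (fun t : ℝ => y + t • b) b 0 :=
    (((hasDerivAt_id (0 : ℝ)).smul_const b).const_add y).congr_deriv (one_smul _ _)
  have hne : ‖y‖ ≠ 0 := norm_ne_zero_iff.mpr hy
  have h := hline.norm_sq.sqrt (by simpa using hy)
  simp only [Real.sqrt_sq (norm_nonneg _), zero_smul, add_zero] at h
  refine h.congr_deriv ?_
  field_simp

/-- A rotating field with angular velocity `A + B ρ + C / ρ` at distance `ρ` from the origin. -/
noncomputable def swirl (A B C : ℝ) (y : Plane) : Plane := (A + B * ‖y‖ + C * ‖y‖⁻¹) • -perp y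

/-- With angular velocity `f(ρ) = A + B ρ + C / ρ`, the scalar `B ρ⁻¹ - C ρ⁻³` is `f'(ρ) / ρ`. -/
lemma hasDerivAt_swirl_line (A B C : ℝ) {y : Plane} (hy : y ≠ 0) (b : Plane) :
    HasDerivAt (fun t : ℝ => swirl A B C (y + t • b))
      (((B * ‖y‖⁻¹ - C * ‖y‖⁻¹ ^ 3) * ⟪y, b⟫) • -perp y +
        (A + B * ‖y‖ + C * ‖y‖⁻¹) • -perp b) 0 := by
  have hne : ‖y‖ ≠ 0 := norm_ne_zero_iff.mpr hy
  have hρ := hasDerivAt_norm_line hy b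
  have hline : HasDerivAt (fun t : ℝ => y + t • b) b 0 :=
    (((hasDerivAt_id (0 : ℝ)).smul_const b).const_add y).congr_deriv (one_smul _ _)
  have hinv := hρ.inv (by simpa using hne)
  have hs := ((hρ.const_mul B).const_add A).add (hinv.const_mul C)
  have hp := (perpL.hasFDerivAt.comp_hasDerivAt 0 hline).neg
  refine (hs.smul hp).congr_deriv ?_
  simp only [Function.comp, perpL_apply, zero_smul, add_zero, Pi.add_apply, Pi.inv_apply,
    Pi.neg_apply]
  rw [add_comm]
  congr 2
  field_simp
  ring

lemma hasDerivAt_swirl_line_two (A B C : ℝ) {y : Plane} (hy : y ≠ 0) (b : Plane) :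
    HasDerivAt (fun t : ℝ => ((B * ‖y + t • b‖⁻¹ - C * ‖y + t • b‖⁻¹ ^ 3) * ⟪y + t • b, b⟫) •
        -perp (y + t • b) + (A + B * ‖y + t • b‖ + C * ‖y + t • b‖⁻¹) • -perp b)
      (((-B * ‖y‖⁻¹ ^ 3 + 3 * C * ‖y‖⁻¹ ^ 5) * ⟪y, b⟫ ^ 2 +
          (B * ‖y‖⁻¹ - C * ‖y‖⁻¹ ^ 3) * ⟪b, b⟫) • -perp y +
        (2 * (B * ‖y‖⁻¹ - C * ‖y‖⁻¹ ^ 3) * ⟪y, b⟫) • -perp b) 0 := by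
  have hne : ‖y‖ ≠ 0 := norm_ne_zero_iff.mpr hy
  have hρ := hasDerivAt_norm_line hy b
  have hline : HasDerivAt (fun t : ℝ => y + t • b) b 0 :=
    (((hasDerivAt_id (0 : ℝ)).smul_const b).const_add y).congr_deriv (one_smul _ _)
  have hinv := hρ.inv (by simpa using hne)
  have hp := (perpL.hasFDerivAt.comp_hasDerivAt 0 hline).neg
  have hin := hline.inner ℝ (hasDerivAt_const (0 : ℝ) b)
  have hs := (((hinv.const_mul B).sub ((hinv.pow 3).const_mul C)).mul hin).smul hp
  have hs' := (((hρ.const_mul B).const_add A).add (hinv.const_mul C)).smul_const (-perp b)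
  refine (hs.add hs').congr_deriv ?_
  simp only [Function.comp, perpL_apply, zero_smul, add_zero, Pi.inv_apply,
    Pi.neg_apply, Pi.sub_apply, Nat.add_one_sub_one, Pi.mul_apply, Pi.pow_apply, inner_zero_right,
    zero_add]
  rw [add_comm (_ • -perp b), add_assoc, ← add_smul]
  congr 2
  · norm_num
    field_simp
    ring
  · field_simp
    ring

lemma contDiffAt_swirl (A B C : ℝ) {y : Plane} (hy : y ≠ 0) :
    ContDiffAt ℝ 2 (swirl A B C) y := by
  have hn : ContDiffAt ℝ 2 (fun y : Plane => ‖y‖) y := contDiffAt_norm ℝ hy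
  have hp : ContDiffAt ℝ 2 (fun y : Plane => -perp y) y := perpL.contDiff.contDiffAt.neg
  exact ((contDiffAt_const.add (contDiffAt_const.mul hn)).add
    (contDiffAt_const.mul (hn.inv (norm_ne_zero_iff.mpr hy)))).smul hp

/-- For angular velocity `f`, the trace of the second directional derivatives gives the factor `f''
+ 3 f' / ρ`. The rigid rotation `A` drops out. -/
lemma laplacian_swirl (A B C : ℝ) {c x : Plane} (hx : x ≠ c) :
    Laplacian.laplacian (fun x => swirl A B C (x - c)) x =
      (3 * B * ‖x - c‖⁻¹ - C * ‖x - c‖⁻¹ ^ 3) • -perp (x - c) := by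
  have hy : x - c ≠ 0 := sub_ne_zero.mpr hx
  have hdir : ∀ b : Plane, fderiv ℝ (fderiv ℝ (fun x => swirl A B C (x - c))) x b b =
      ((-B * ‖x - c‖⁻¹ ^ 3 + 3 * C * ‖x - c‖⁻¹ ^ 5) * ⟪x - c, b⟫ ^ 2 +
          (B * ‖x - c‖⁻¹ - C * ‖x - c‖⁻¹ ^ 3) * ⟪b, b⟫) • -perp (x - c) +
        (2 * (B * ‖x - c‖⁻¹ - C * ‖x - c‖⁻¹ ^ 3) * ⟪x - c, b⟫) • -perp b := fun b => by
    have hcd : ContDiffAt ℝ 2 (fun x => swirl A B C (x - c)) x :=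
      ContDiffAt.comp x (g := swirl A B C) (f := fun x => x - c) (contDiffAt_swirl A B C hy)
        (contDiffAt_id.sub contDiffAt_const)
    refine fderiv_fderiv_apply_eq (g₁ := fun x =>
      ((B * ‖x - c‖⁻¹ - C * ‖x - c‖⁻¹ ^ 3) * ⟪x - c, b⟫) • -perp (x - c) +
        (A + B * ‖x - c‖ + C * ‖x - c‖⁻¹) • -perp b) hcd ?_ ?_
    · filter_upwards [isOpen_ne.mem_nhds hx] with z hz
      have := hasDerivAt_swirl_line A B C (sub_ne_zero.mpr hz) b
      simpa only [sub_add_eq_add_sub] using this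
    · have := hasDerivAt_swirl_line_two A B C hy b
      simpa only [sub_add_eq_add_sub] using this
  rw [laplacian_eq_sum]
  simp only [hdir, Fin.sum_univ_two]
  have hne : ‖x - c‖ ≠ 0 := norm_ne_zero_iff.mpr hy
  have hn2 : ‖x - c‖ ^ 2 = (x - c) 0 ^ 2 + (x - c) 1 ^ 2 := by
    rw [EuclideanSpace.norm_sq_eq]; simp [Fin.sum_univ_two]
  generalize x - c = y at *
  generalize ‖y‖ = ρ at *
  -- Summing `⟪y, b⟫ ^ 2` over the basis produces `|y|²`; these identities absorb it into the powers
  -- of `ρ⁻¹`.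
  have e : ρ⁻¹ ^ 3 = ρ⁻¹ ^ 5 * (y 0 ^ 2 + y 1 ^ 2) := by rw [← hn2]; field_simp
  have e' : ρ⁻¹ = ρ⁻¹ ^ 3 * (y 0 ^ 2 + y 1 ^ 2) := by rw [← hn2]; field_simp
  apply plane_ext
  · simp [inner_eq]
    linear_combination (-3 * C * y 1) * e + (B * y 1) * e'
  · simp [inner_eq]
    linear_combination (3 * C * y 0) * e - (B * y 0) * e'

end Laplacian

/-! ### The flow over the circular arc, and the inward normal -/

section Arc

variable {Ω : Set Plane} {φ : ℝ → Plane} {s₀ s₂ δ : ℝ}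

lemma IsBoundaryCurve.contDiff_normalCoord (hφ : IsBoundaryCurve Ω φ s₀ s₂ δ) :
    ContDiff ℝ ∞ (fun z : ℝ × ℝ => normalCoord φ z.1 z.2) :=
  (hφ.smooth.comp contDiff_fst).add
    (contDiff_snd.smul (perpL.contDiff.comp (hφ.contDiff_deriv.comp contDiff_fst)))

/-- The normal coordinates are open maps on the side of the domain. -/
lemma IsBoundaryCurve.image_normalCoord_mem_nhds (hφ : IsBoundaryCurve Ω φ s₀ s₂ δ) {s r : ℝ}
    (hr : 0 < r) {O : Set (ℝ × ℝ)} (hO : O ∈ 𝓝 (s, r)) :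
    (fun z : ℝ × ℝ => normalCoord φ z.1 z.2) '' O ∈ 𝓝 (normalCoord φ s r) := by
  have hst := hφ.contDiff_normalCoord.contDiffAt.hasStrictFDerivAt (x := (s, r)) (by simp)
  set D := fderiv ℝ (fun z : ℝ × ℝ => normalCoord φ z.1 z.2) (s, r)
  have h1 : D (1, 0) = (1 + r * ‖deriv (deriv φ) s‖) • deriv φ s :=
    HasDerivAt.unique (f := fun s => normalCoord φ s r) (hst.hasFDerivAt.comp_hasDerivAt
      (f := fun s => (s, r)) s ((hasDerivAt_id' s).prodMk (hasDerivAt_const s r))) (hφ.hasDerivAt_normalCoord s r)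
  have h2 : D (0, 1) = perp (deriv φ s) :=
    HasDerivAt.unique (f := fun r => normalCoord φ s r) (hst.hasFDerivAt.comp_hasDerivAt r
      ((hasDerivAt_const r s).prodMk (hasDerivAt_id r))) (hasDerivAt_normalCoord_right φ s r)
  have hpos : 0 < 1 + r * ‖deriv (deriv φ) s‖ := by positivity
  -- The columns of `D` are `(1 + r κ) τ` and `n`, a basis because `r > 0` and `κ ≥ 0`.
  have hsurj : D.range = ⊤ := by
    rw [LinearMap.range_eq_top]
    intro w
    refine ⟨(⟪w, deriv φ s⟫ / (1 + r * ‖deriv (deriv φ) s‖)) • ((1 : ℝ), (0 : ℝ)) +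
      ⟪w, perp (deriv φ s)⟫ • ((0 : ℝ), (1 : ℝ)), ?_⟩
    show D _ = w
    rw [map_add, map_smul, map_smul, h1, h2, smul_smul, div_mul_cancel₀ _ hpos.ne']
    exact (eq_frame (hφ.unit_speed s) w).symm
  have := hst.map_nhds_eq_of_surj hsurj
  rw [← this]
  exact image_mem_map hO

/-- The normal coordinates over the arc are polar coordinates around its centre. -/
lemma IsBoundaryCurve.normalCoord_sub_center (hφ : IsBoundaryCurve Ω φ s₀ s₂ δ) {s r : ℝ}
    (hs : s ∈ Icc 0 s₂) (hr : 0 < r) :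
    ‖normalCoord φ s r - (φ 0 - δ • perp (deriv φ 0))‖ = δ + r ∧
    -perp (normalCoord φ s r - (φ 0 - δ • perp (deriv φ 0))) = (δ + r) • deriv φ s := by
  have e : normalCoord φ s r - (φ 0 - δ • perp (deriv φ 0)) = (δ + r) • perp (deriv φ s) := by
    rw [← hφ.center_eq hs, normalCoord, add_smul]; abel
  have hpos : 0 < δ + r := add_pos hφ.δ_pos hr
  rw [e]
  refine ⟨?_, ?_⟩
  · rw [norm_smul, norm_perp, hφ.unit_speed, mul_one, Real.norm_of_nonneg hpos.le]
  · rw [perp_smul, perp_perp, smul_neg, neg_neg]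

/-- The Laplacian of a laminar profile with quadratic velocity over the circular arc. -/
lemma IsBoundaryCurve.laplacian_arc (hφ : IsBoundaryCurve Ω φ s₀ s₂ δ) {v : Plane → Plane}
    {ρ α₁ α₂ : ℝ} (hv : ∀ s ∈ Icc s₀ s₂, ∀ r ∈ Ioo 0 ρ,
      v (normalCoord φ s r) = (α₁ * r - α₂ / 2 * r ^ 2) • deriv φ s)
    {s r : ℝ} (hs : s ∈ Ioo 0 s₂) (hr : r ∈ Ioo 0 ρ) :
    Laplacian.laplacian v (normalCoord φ s r) =
      (-(3 / 2 * α₂) + (α₁ * δ + α₂ / 2 * δ ^ 2) / (δ + r) ^ 2) • deriv φ s := by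
  set c := φ 0 - δ • perp (deriv φ 0) with hc
  have hpos : 0 < δ + r := add_pos hφ.δ_pos hr.1
  -- The coefficients come from expanding `h(d - δ) / d` in the distance `d = δ + r` to the centre.
  -- Equality on a neighbourhood is what the Laplacian needs.
  have heq : v =ᶠ[𝓝 (normalCoord φ s r)] fun x =>
      swirl (α₁ + α₂ * δ) (-(α₂ / 2)) (-(α₁ * δ + α₂ / 2 * δ ^ 2)) (x - c) := by
    have hO : Ioo 0 s₂ ×ˢ Ioo 0 ρ ∈ 𝓝 (s, r) := (isOpen_Ioo.prod isOpen_Ioo).mem_nhds ⟨hs, hr⟩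
    filter_upwards [hφ.image_normalCoord_mem_nhds hr.1 hO]
    rintro _ ⟨⟨s', r'⟩, ⟨hs', hr'⟩, rfl⟩
    have hpos' : 0 < δ + r' := add_pos hφ.δ_pos hr'.1
    obtain ⟨h1, h2⟩ := hφ.normalCoord_sub_center (Ioo_subset_Icc_self hs') hr'.1
    rw [← hc] at h1 h2
    show v (normalCoord φ s' r') = _
    rw [swirl, h1, h2, hv s' ⟨hφ.s₀_neg.le.trans hs'.1.le, hs'.2.le⟩ r' hr', smul_smul]
    congr 1
    field_simp
    ring
  obtain ⟨h1, h2⟩ := hφ.normalCoord_sub_center (Ioo_subset_Icc_self hs) hr.1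
  rw [← hc] at h1 h2
  have hne : normalCoord φ s r ≠ c := by
    rw [← sub_ne_zero, ← norm_ne_zero_iff, h1]; exact hpos.ne'
  rw [(InnerProductSpace.laplacian_congr_nhds heq).eq_of_nhds, laplacian_swirl _ _ _ hne, h1, h2,
    smul_smul]
  congr 1
  field_simp
  ring

/-- A defining function of the domain increases in the direction of the normal. -/
lemma IsBoundaryCurve.fderiv_perp_pos (hφ : IsBoundaryCurve Ω φ s₀ s₂ δ) (hΩ : IsOpen Ω) {s : ℝ}
    (hs : s ∈ Icc s₀ s₂) {U : Set Plane} {g : Plane → ℝ} (hU : IsOpen U) (hx : φ s ∈ U)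
    (hg : DifferentiableAt ℝ g (φ s)) (hg0 : g (φ s) = 0) (hdg : fderiv ℝ g (φ s) ≠ 0)
    (hgΩ : Ω ∩ U = {y ∈ U | 0 < g y}) :
    0 < fderiv ℝ g (φ s) (perp (deriv φ s)) := by
  -- The curve never enters the open set `Ω`, so `g ∘ φ ≤ 0` near `s`, with its maximum `0` attained
  -- at `s`.
  have htan : fderiv ℝ g (φ s) (deriv φ s) = 0 := by
    refine IsLocalMax.hasDerivAt_eq_zero (f := g ∘ φ) ?_
      (hg.hasFDerivAt.comp_hasDerivAt s (hφ.hasDerivAt s))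
    filter_upwards [(hφ.hasDerivAt s).continuousAt.eventually (hU.mem_nhds hx)] with t ht
    show g (φ t) ≤ g (φ s)
    rw [hg0]
    by_contra hcon
    have hmem : φ t ∈ Ω ∩ U := by rw [hgΩ]; exact ⟨ht, not_le.mp hcon⟩
    have hfr := hφ.mem_frontier t
    rw [hΩ.frontier_eq] at hfr
    exact hfr.2 hmem.1
  have hne : fderiv ℝ g (φ s) (perp (deriv φ s)) ≠ 0 := by
    intro h0
    refine hdg (ContinuousLinearMap.ext fun w => ?_)
    rw [eq_frame (hφ.unit_speed s) w, map_add, map_smul, map_smul, htan, h0]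
    simp
  -- With the opposite sign `g` would be negative just along the normal, where the points belong to
  -- `Ω`.
  refine lt_of_le_of_ne (not_lt.mp fun hneg => ?_) hne.symm
  have h1 : 0 < fderiv ℝ g (φ s) (-perp (deriv φ s)) := by rw [map_neg]; linarith
  have hev := (eventually_mem_of_fderiv_pos hU hx hg hg0 hgΩ h1).2
  obtain ⟨ρ, hρ, hin⟩ := hφ.interior_side
  obtain ⟨t, ⟨htU, htg⟩, ht⟩ := (hev.and (Ioo_mem_nhdsGT hρ)).exists
  rw [smul_neg, sub_neg_eq_add] at htU htg
  have hmem : φ s + t • perp (deriv φ s) ∈ Ω ∩ U := ⟨hin s hs t ht, htU⟩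
  rw [hgΩ] at hmem
  exact absurd hmem.2 (not_lt.mpr htg.le)

end Arc

/-! ### Derivatives up to the boundary -/

section Closure

variable {Ω : Set Plane}

lemma closure_mem_nhds_of_mem (hΩ : IsOpen Ω) {x : Plane} (hx : x ∈ Ω) : closure Ω ∈ 𝓝 x :=
  mem_of_superset (hΩ.mem_nhds hx) subset_closure

lemma fderivWithin_closure_of_mem {F : Type*} [NormedAddCommGroup F] [NormedSpace ℝ F]
    (hΩ : IsOpen Ω) (f : Plane → F) {x : Plane} (hx : x ∈ Ω) :
    fderivWithin ℝ f (closure Ω) x = fderiv ℝ f x :=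
  fderivWithin_of_mem_nhds (closure_mem_nhds_of_mem hΩ hx)

/-- The Laplacian, extended to the closure of the domain. -/
noncomputable def lapClosure (Ω : Set Plane) (f : Plane → Plane) (x : Plane) : Plane :=
  ∑ i : Fin 2, fderivWithin ℝ (fderivWithin ℝ f (closure Ω)) (closure Ω) x
    (EuclideanSpace.basisFun (Fin 2) ℝ i) (EuclideanSpace.basisFun (Fin 2) ℝ i)

lemma lapClosure_of_mem (hΩ : IsOpen Ω) (f : Plane → Plane) {x : Plane} (hx : x ∈ Ω) :
    lapClosure Ω f x = Laplacian.laplacian f x := by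
  rw [laplacian_eq_sum, lapClosure, fderivWithin_closure_of_mem hΩ _ hx]
  have : fderivWithin ℝ f (closure Ω) =ᶠ[𝓝 x] fderiv ℝ f := by
    filter_upwards [hΩ.mem_nhds hx] with y hy using fderivWithin_closure_of_mem hΩ f hy
  rw [this.fderiv_eq]

lemma contDiffOn_lapClosure (hud : UniqueDiffOn ℝ (closure Ω)) {f : Plane → Plane}
    (hf : ContDiffOn ℝ ∞ f (closure Ω)) : ContDiffOn ℝ ∞ (lapClosure Ω f) (closure Ω) := by
  have h1 : ContDiffOn ℝ ∞ (fderivWithin ℝ f (closure Ω)) (closure Ω) :=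
    hf.fderivWithin hud (by simp)
  have h2 : ContDiffOn ℝ ∞ (fderivWithin ℝ (fderivWithin ℝ f (closure Ω)) (closure Ω))
      (closure Ω) := h1.fderivWithin hud (by simp)
  exact ContDiffOn.sum fun i _ => (h2.clm_apply contDiffOn_const).clm_apply contDiffOn_const

end Closure

/-! ### The initial force and its vanishing on the boundary -/

section NavierStokes

variable {Ω : Set Plane} {ν T : ℝ} {u₀ : Plane → Plane} {u : ℝ → Plane → Plane}
  {p : ℝ → Plane → ℝ}

/-- The initial material derivative extends continuously to the closure of the domain, and
vanishes at the boundary. -/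
lemma IsNavierStokesSolution.exists_materialDeriv_extension
    (hu : IsNavierStokesSolution ν Ω T u₀ u p) (hΩ : IsSmoothDomain Ω) (hT : 0 < T) :
    ∃ W : Plane → Plane, ContinuousOn W (closure Ω) ∧ (∀ x ∈ Ω, W x = materialDeriv u 0 x) ∧
      ∀ x ∈ frontier Ω, W x = 0 := by
  set K := closure Ω with hK
  set S := Ico 0 T ×ˢ K with hS
  have h0 : (0 : ℝ) ∈ Ico 0 T := ⟨le_rfl, hT⟩
  have hudI : UniqueDiffOn ℝ (Ico 0 T) := uniqueDiffOn_Ico 0 T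
  have hud : UniqueDiffOn ℝ S := hudI.prod hΩ.uniqueDiffOn_closure
  set D := fderivWithin ℝ (fun z : ℝ × Plane => u z.1 z.2) S with hD
  have hDc : ContinuousOn D S := hu.regular.continuousOn_fderivWithin hud le_rfl
  have hder : ∀ x ∈ K, HasFDerivWithinAt (fun z : ℝ × Plane => u z.1 z.2) (D (0, x)) S (0, x) :=
    fun x hx => (hu.regular.differentiableOn one_ne_zero (0, x) ⟨h0, hx⟩).hasFDerivWithinAt
  have htime : ∀ x ∈ K, HasDerivWithinAt (fun τ => u τ x) (D (0, x) (1, 0)) (Ico 0 T) 0 :=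
    fun x hx => HasFDerivWithinAt.comp_hasDerivWithinAt (f := fun τ : ℝ => (τ, x)) 0 (hder x hx)
      ((hasDerivAt_id' (0 : ℝ)).prodMk (hasDerivAt_const (0 : ℝ) x)).hasDerivWithinAt
      fun τ hτ => ⟨hτ, hx⟩
  have hu0c : ContinuousOn (u 0) K :=
    ContinuousOn.comp (g := fun z : ℝ × Plane => u z.1 z.2) (f := fun x => ((0 : ℝ), x)) (t := S)
      hu.regular.continuousOn (by fun_prop) fun x hx => ⟨h0, hx⟩
  -- The material derivative is the space-time derivative in the direction `(1, u)`; on the boundary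
  -- this direction is `(1, 0)`, along which `u` stays zero.
  refine ⟨fun x => D (0, x) (1, u 0 x), ?_, fun x hx => ?_, fun x hx => ?_⟩
  · refine ContinuousOn.clm_apply ?_ (continuousOn_const.prodMk hu0c)
    exact hDc.comp (f := fun x => ((0 : ℝ), x)) (by fun_prop) fun x hx => ⟨h0, hx⟩
  · have hxK := subset_closure hx
    have e1 : timeDeriv u 0 x = D (0, x) (1, 0) :=
      ((htime x hxK).mono_of_mem_nhdsWithin (Ico_mem_nhdsGE hT)).derivWithin
        (uniqueDiffOn_Ici 0 0 self_mem_Ici)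
    have e2 : HasFDerivWithinAt (u 0) ((D (0, x)).comp (ContinuousLinearMap.inr ℝ ℝ Plane)) K x :=
      (hder x hxK).comp (f := fun y => ((0 : ℝ), y)) x (hasFDerivAt_prodMk_right 0 x).hasFDerivWithinAt
        fun y hy => ⟨h0, hy⟩
    have e3 := (e2.hasFDerivAt (closure_mem_nhds_of_mem hΩ.isOpen hx)).fderiv
    rw [materialDeriv, e1, e3, ContinuousLinearMap.comp_apply, ContinuousLinearMap.inr_apply,
      ← map_add]
    simp
  · have hz : ∀ τ ∈ Ico 0 T, u τ x = 0 := fun τ hτ => hu.no_slip τ hτ x hx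
    have e1 := (hudI 0 h0).eq_deriv _ (htime x (frontier_subset_closure hx))
      ((hasDerivWithinAt_const 0 (Ico 0 T) (0 : Plane)).congr hz (hz 0 h0))
    show D (0, x) (1, u 0 x) = 0
    rw [hz 0 h0, e1]

/-- The viscous force minus the pressure force, tested with a vector. -/
noncomputable def forceClosure (ν : ℝ) (Ω : Set Plane) (u₀ : Plane → Plane) (q : Plane → ℝ)
    (w x : Plane) : ℝ :=
  ν * ⟪lapClosure Ω u₀ x, w⟫ - fderivWithin ℝ q (closure Ω) x w

lemma contDiffOn_forceClosure (hud : UniqueDiffOn ℝ (closure Ω))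
    (hu₀ : ContDiffOn ℝ ∞ u₀ (closure Ω)) {q : Plane → ℝ} (hq : ContDiffOn ℝ ∞ q (closure Ω))
    (ν : ℝ) (w : Plane) : ContDiffOn ℝ ∞ (forceClosure ν Ω u₀ q w) (closure Ω) :=
  (contDiffOn_const.mul ((contDiffOn_lapClosure hud hu₀).inner ℝ contDiffOn_const)).sub
    ((hq.fderivWithin hud (by simp)).clm_apply contDiffOn_const)

lemma IsNavierStokesSolution.eventuallyEq_initial (hu : IsNavierStokesSolution ν Ω T u₀ u p)
    (hΩ : IsOpen Ω) {x : Plane} (hx : x ∈ Ω) : u 0 =ᶠ[𝓝 x] u₀ := by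
  filter_upwards [hΩ.mem_nhds hx] with y hy using hu.initial y (subset_closure hy)

lemma IsNavierStokesSolution.forceClosure_eq (hu : IsNavierStokesSolution ν Ω T u₀ u p)
    (hΩ : IsOpen Ω) (hT : 0 < T) (w : Plane) {x : Plane} (hx : x ∈ Ω) :
    forceClosure ν Ω u₀ (p 0) w x = ⟪materialDeriv u 0 x, w⟫ := by
  have hm := hu.momentum 0 ⟨le_rfl, hT⟩ x hx
  have hM : materialDeriv u 0 x = ν • Laplacian.laplacian (u 0) x - gradient (p 0) x := by
    rw [materialDeriv, sub_eq_add_neg, ← hm]; abel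
  rw [hM, (InnerProductSpace.laplacian_congr_nhds (hu.eventuallyEq_initial hΩ hx)).eq_of_nhds,
    forceClosure, lapClosure_of_mem hΩ _ hx, fderivWithin_closure_of_mem hΩ _ hx, inner_sub_left,
    inner_smul_left, gradient, InnerProductSpace.toDual_symm_apply]
  simp

/-- The force and the extended material derivative are continuous on the closure and agree in `Ω`,
hence also on the boundary. This is the compatibility condition that determines the pressure
gradient there. -/
lemma IsNavierStokesSolution.forceClosure_frontier (hu : IsNavierStokesSolution ν Ω T u₀ u p)
    (hΩ : IsSmoothDomain Ω) (hT : 0 < T) (hu₀ : ContDiffOn ℝ ∞ u₀ (closure Ω))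
    (hp₀ : ContDiffOn ℝ ∞ (p 0) (closure Ω)) (w : Plane) {x : Plane} (hx : x ∈ frontier Ω) :
    forceClosure ν Ω u₀ (p 0) w x = 0 := by
  obtain ⟨W, hWc, hW, hW0⟩ := hu.exists_materialDeriv_extension hΩ hT
  have heq : EqOn (forceClosure ν Ω u₀ (p 0) w) (fun x => ⟪W x, w⟫) (closure Ω) := by
    refine EqOn.of_subset_closure (s := Ω) (fun x hx => ?_)
      (contDiffOn_forceClosure hΩ.uniqueDiffOn_closure hu₀ hp₀ ν w).continuousOn
      (hWc.inner continuousOn_const) subset_closure subset_rfl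
    show _ = ⟪W x, w⟫
    rw [hu.forceClosure_eq hΩ.isOpen hT w hx, hW x hx]
  rw [heq (frontier_subset_closure hx)]
  simp [hW0 x hx]

end NavierStokes

/-! ### Normal derivative of the tangential force on the arc -/

section BoundaryDerivatives

variable {Ω : Set Plane} {φ : ℝ → Plane} {s₀ s₂ δ : ℝ}

/-- The Laplacian of the laminar profile, up to the boundary arc. -/
lemma IsBoundaryCurve.lapClosure_arc (hφ : IsBoundaryCurve Ω φ s₀ s₂ δ) (hΩ : IsSmoothDomain Ω)
    {v : Plane → Plane} (hvs : ContDiffOn ℝ ∞ v (closure Ω)) {ρ α₁ α₂ : ℝ} (hρ : 0 < ρ)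
    (hv : ∀ s ∈ Icc s₀ s₂, ∀ r ∈ Ioo 0 ρ, normalCoord φ s r ∈ Ω ∧
      v (normalCoord φ s r) = (α₁ * r - α₂ / 2 * r ^ 2) • deriv φ s)
    {s r : ℝ} (hs : s ∈ Icc 0 s₂) (hr : r ∈ Ico 0 ρ) :
    lapClosure Ω v (normalCoord φ s r) =
      (-(3 / 2 * α₂) + (α₁ * δ + α₂ / 2 * δ ^ 2) / (δ + r) ^ 2) • deriv φ s := by
  have hmem : ∀ z ∈ Icc 0 s₂ ×ˢ Ico 0 ρ, normalCoord φ z.1 z.2 ∈ closure Ω := by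
    rintro ⟨s, r⟩ ⟨hs, hr⟩
    rcases hr.1.eq_or_lt with h | h
    · show normalCoord φ s r ∈ closure Ω
      have h : r = 0 := h.symm
      rw [h, normalCoord_zero]
      exact frontier_subset_closure (hφ.mem_frontier s)
    · exact subset_closure (hv s ⟨hφ.s₀_neg.le.trans hs.1, hs.2⟩ r ⟨h, hr.2⟩).1
  have heq : EqOn (fun z : ℝ × ℝ => lapClosure Ω v (normalCoord φ z.1 z.2))
      (fun z => (-(3 / 2 * α₂) + (α₁ * δ + α₂ / 2 * δ ^ 2) / (δ + z.2) ^ 2) • deriv φ z.1)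
      (Icc 0 s₂ ×ˢ Ico 0 ρ) := by
    -- The explicit Laplacian is available over the open sector only; continuity carries it to `r =
    -- 0` and to the ends of the arc.
    refine EqOn.of_subset_closure (s := Ioo 0 s₂ ×ˢ Ioo 0 ρ) ?_ ?_ ?_
      (prod_mono Ioo_subset_Icc_self Ioo_subset_Ico_self) ?_
    · rintro ⟨s, r⟩ ⟨hs, hr⟩
      have hs' : s ∈ Icc s₀ s₂ := ⟨hφ.s₀_neg.le.trans hs.1.le, hs.2.le⟩
      show lapClosure Ω v (normalCoord φ s r) = _
      rw [lapClosure_of_mem hΩ.isOpen _ (hv s hs' r hr).1,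
        hφ.laplacian_arc (fun s hs r hr => (hv s hs r hr).2) hs hr]
    · exact (contDiffOn_lapClosure hΩ.uniqueDiffOn_closure hvs).continuousOn.comp
        hφ.contDiff_normalCoord.continuous.continuousOn hmem
    · refine ContinuousOn.smul (M := ℝ) (X := Plane) ?_
        (hφ.contDiff_deriv.continuous.comp (continuous_fst (X := ℝ) (Y := ℝ))).continuousOn
      refine ContinuousOn.add continuousOn_const (ContinuousOn.div continuousOn_const ?_ fun z hz => ?_)
      · fun_prop
      have := add_pos_of_pos_of_nonneg hφ.δ_pos hz.2.1
      positivity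
    · rw [closure_prod_eq, closure_Ioo hφ.s₂_pos.ne, closure_Ioo hρ.ne]
      exact prod_mono subset_rfl Ico_subset_Icc_self
  exact heq (x := (s, r)) ⟨hs, hr⟩

/-- The inward normal derivative at the boundary, computed along the normal. -/
lemma IsBoundaryCurve.fderivWithin_perp (hφ : IsBoundaryCurve Ω φ s₀ s₂ δ)
    {F : Type*} [NormedAddCommGroup F] [NormedSpace ℝ F] {f : Plane → F} {s ρ : ℝ}
    (hρ : 0 < ρ) (hmem : ∀ r ∈ Ioo 0 ρ, normalCoord φ s r ∈ Ω)
    (hf : DifferentiableOn ℝ f (closure Ω)) {k : ℝ → F} {k' : F}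
    (hk : ∀ r ∈ Ico 0 ρ, f (normalCoord φ s r) = k r) (hk' : HasDerivAt k k' 0) :
    fderivWithin ℝ f (closure Ω) (φ s) (perp (deriv φ s)) = k' := by
  have hmaps : MapsTo (fun r => normalCoord φ s r) (Ico 0 ρ) (closure Ω) := fun r hr => by
    rcases hr.1.eq_or_lt with h | h
    · show normalCoord φ s r ∈ closure Ω
      rw [← h, normalCoord_zero]; exact frontier_subset_closure (hφ.mem_frontier s)
    · exact subset_closure (hmem r ⟨h, hr.2⟩)
  have h0 : (0 : ℝ) ∈ Ico 0 ρ := ⟨le_rfl, hρ⟩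
  have h1 := (hf _ (frontier_subset_closure (hφ.mem_frontier s))).hasFDerivWithinAt
  have h2 := h1.comp_hasDerivWithinAt_of_eq (0 : ℝ)
    ((hasDerivAt_normalCoord_right φ s 0).hasDerivWithinAt (s := Ico 0 ρ)) hmaps
    (normalCoord_zero φ s).symm
  exact (uniqueDiffOn_Ico 0 ρ 0 h0).eq_deriv _ h2 (hk'.hasDerivWithinAt.congr hk (hk 0 h0))

/-- The tangential derivative at the boundary, computed along the boundary. -/
lemma IsBoundaryCurve.fderivWithin_deriv (hφ : IsBoundaryCurve Ω φ s₀ s₂ δ)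
    {F : Type*} [NormedAddCommGroup F] [NormedSpace ℝ F] {f : Plane → F} {s : ℝ}
    (hs : s ∈ Icc 0 s₂) (hf : DifferentiableOn ℝ f (closure Ω)) {k : ℝ → F} {k' : F}
    (hk : ∀ s ∈ Icc 0 s₂, f (φ s) = k s) (hk' : HasDerivAt k k' s) :
    fderivWithin ℝ f (closure Ω) (φ s) (deriv φ s) = k' := by
  have h1 := (hf _ (frontier_subset_closure (hφ.mem_frontier s))).hasFDerivWithinAt
  have h2 := h1.comp_hasDerivWithinAt s ((hφ.hasDerivAt s).hasDerivWithinAt (s := Icc 0 s₂))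
    fun t _ => frontier_subset_closure (hφ.mem_frontier t)
  exact (uniqueDiffOn_Icc hφ.s₂_pos s hs).eq_deriv _ h2
    (hk'.hasDerivWithinAt.congr hk (hk s hs))

lemma IsSmoothDomain.fderivWithin_fderivWithin_comm (hΩ : IsSmoothDomain Ω) {q : Plane → ℝ}
    (hq : ContDiffOn ℝ ∞ q (closure Ω)) {x : Plane} (hx : x ∈ closure Ω) (a b : Plane) :
    fderivWithin ℝ (fderivWithin ℝ q (closure Ω)) (closure Ω) x a b =
      fderivWithin ℝ (fderivWithin ℝ q (closure Ω)) (closure Ω) x b a := by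
  refine ((hq x hx).isSymmSndFDerivWithinAt
    (by simpa using WithTop.coe_le_coe.mpr (le_top : (2 : ℕ∞) ≤ ⊤))
    hΩ.uniqueDiffOn_closure ?_ hx) a b
  exact closure_mono (hΩ.isOpen.subset_interior_iff.mpr subset_closure) hx

/-- The normal derivative of the tangential force at the boundary arc. -/
lemma IsBoundaryCurve.fderivWithin_forceClosure (hφ : IsBoundaryCurve Ω φ s₀ s₂ δ)
    (hΩ : IsSmoothDomain Ω) {v : Plane → Plane} (hvs : ContDiffOn ℝ ∞ v (closure Ω))
    {q : Plane → ℝ} (hq : ContDiffOn ℝ ∞ q (closure Ω)) {ν ρ α₁ α₂ : ℝ} (hρ : 0 < ρ)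
    (hv : ∀ s ∈ Icc s₀ s₂, ∀ r ∈ Ioo 0 ρ, normalCoord φ s r ∈ Ω ∧
      v (normalCoord φ s r) = (α₁ * r - α₂ / 2 * r ^ 2) • deriv φ s)
    (hforce : ∀ w, ∀ x ∈ frontier Ω, forceClosure ν Ω v q w x = 0)
    {s : ℝ} (hs : s ∈ Icc 0 s₂) :
    fderivWithin ℝ (forceClosure ν Ω v q (deriv φ s)) (closure Ω) (φ s) (perp (deriv φ s)) =
      -(2 * ν * α₂ / δ) - ν * α₁ / δ ^ 2 := by
  have hud := hΩ.uniqueDiffOn_closure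
  have hxK : φ s ∈ closure Ω := frontier_subset_closure (hφ.mem_frontier s)
  have hδ := hφ.δ_pos.ne'
  have hs' : s ∈ Icc s₀ s₂ := ⟨hφ.s₀_neg.le.trans hs.1, hs.2⟩
  set P := fderivWithin ℝ q (closure Ω) with hP
  set L := lapClosure Ω v with hL
  -- The tangential viscous force at `r = 0`, that is `ν (α₁ / δ - α₂)`.
  set m := ν * (-(3 / 2 * α₂) + (α₁ * δ + α₂ / 2 * δ ^ 2) / δ ^ 2) with hm
  have hPd : DifferentiableOn ℝ P (closure Ω) :=
    ContDiffOn.differentiableOn (n := ∞) (hq.fderivWithin hud (by simp)) (by simp)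
  have hLd : DifferentiableOn ℝ L (closure Ω) :=
    ContDiffOn.differentiableOn (n := ∞) (contDiffOn_lapClosure hud hvs) (by simp)
  have hLn : fderivWithin ℝ L (closure Ω) (φ s) (perp (deriv φ s)) =
      (-(2 * (α₁ * δ + α₂ / 2 * δ ^ 2) / δ ^ 3)) • deriv φ s := by
    refine hφ.fderivWithin_perp hρ (fun r hr => (hv s hs' r hr).1) hLd
      (fun r hr => hφ.lapClosure_arc hΩ hvs hρ hv hs hr) ?_
    have h1 : HasDerivAt (fun r : ℝ => (δ + r) ^ 2) (2 * (δ + 0)) 0 := by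
      have := ((hasDerivAt_id (0 : ℝ)).const_add δ).pow 2
      refine this.congr_deriv ?_
      norm_num
    have h2 := (((hasDerivAt_const (0 : ℝ) (α₁ * δ + α₂ / 2 * δ ^ 2)).div h1
      (by simpa using hδ)).const_add (-(3 / 2 * α₂))).smul_const (deriv φ s)
    refine h2.congr_deriv ?_
    congr 1
    simp only [add_zero]
    field_simp
    ring
  have hPb : ∀ s ∈ Icc 0 s₂, P (φ s) = m • innerSL ℝ (deriv φ s) := fun s hs => by
    ext w
    have h1 := hforce w (φ s) (hφ.mem_frontier s)
    have h2 := hφ.lapClosure_arc hΩ hvs hρ hv hs ⟨le_rfl, hρ⟩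
    rw [normalCoord_zero, add_zero] at h2
    rw [forceClosure, h2, inner_smul_left, sub_eq_zero] at h1
    rw [hP, ← h1]
    simp [hm, mul_assoc]
  have hPt : fderivWithin ℝ P (closure Ω) (φ s) (deriv φ s) =
      m • innerSL ℝ (-((1 / δ) • perp (deriv φ s))) := by
    refine hφ.fderivWithin_deriv hs hPd hPb ?_
    have h1 := hφ.hasDerivAt_deriv s
    rw [hφ.curvature_arc s hs] at h1
    exact ((innerSL ℝ (E := Plane)).hasFDerivAt.comp_hasDerivAt s h1).const_smul m
  -- Symmetry of the second derivative replaces the unknown normal derivative of `∂_τ p` by a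
  -- derivative along the arc, where `∇p = m τ` is known.
  have hPn : fderivWithin ℝ P (closure Ω) (φ s) (perp (deriv φ s)) (deriv φ s) = -(m / δ) := by
    rw [hP, hΩ.fderivWithin_fderivWithin_comm hq hxK, ← hP, hPt]
    have h1 : ⟪perp (deriv φ s), perp (deriv φ s)⟫ = 1 := by
      rw [inner_perp_perp, inner_self_of_norm_one (hφ.unit_speed s)]
    simp only [smul_apply, innerSL_apply_apply, inner_neg_left,
      inner_smul_left, h1, conj_trivial, smul_eq_mul]
    ring
  have hfd : HasFDerivWithinAt (forceClosure ν Ω v q (deriv φ s))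
      (ν • (innerSL ℝ (deriv φ s)).comp (fderivWithin ℝ L (closure Ω) (φ s)) -
        (ContinuousLinearMap.apply ℝ ℝ (deriv φ s)).comp (fderivWithin ℝ P (closure Ω) (φ s)))
      (closure Ω) (φ s) := by
    have h1 := (innerSL ℝ (deriv φ s)).hasFDerivAt.comp_hasFDerivWithinAt (φ s)
      (hLd _ hxK).hasFDerivWithinAt
    have h2 := (ContinuousLinearMap.apply ℝ ℝ (deriv φ s)).hasFDerivAt.comp_hasFDerivWithinAt (φ s)
      (hPd _ hxK).hasFDerivWithinAt
    refine ((h1.const_smul ν).sub h2).congr (fun x _ => ?_) ?_ <;>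
    simp [forceClosure, hP, hL, real_inner_comm]
  rw [hfd.fderivWithin (hud _ hxK)]
  simp only [sub_apply, smul_apply,
    ContinuousLinearMap.comp_apply, ContinuousLinearMap.apply_apply, hLn, hPn,
    innerSL_apply_apply, inner_smul_right, inner_self_of_norm_one (hφ.unit_speed s), smul_eq_mul]
  rw [hm]
  field_simp
  ring

end BoundaryDerivatives

end LaminarFlow

/-! ### The limit, its sign and its monotonicity in the radius -/

theorem mainTheorem2
    (Ω : Set LaminarFlow.Plane) (hΩ : LaminarFlow.IsSmoothDomain Ω)
    (φ : ℝ → LaminarFlow.Plane) (s₀ s₂ δ : ℝ)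
    (hφ : LaminarFlow.IsBoundaryCurve Ω φ s₀ s₂ δ)
    (ν α₁ α₂ T : ℝ) (hν : 0 < ν) (hα₁ : 0 < α₁) (hα₂ : 0 < α₂) (hT : 0 < T)
    (u₀ : LaminarFlow.Plane → LaminarFlow.Plane)
    (u : ℝ → LaminarFlow.Plane → LaminarFlow.Plane) (p : ℝ → LaminarFlow.Plane → ℝ)
    (hu : LaminarFlow.IsNavierStokesSolution ν Ω T u₀ u p)
    (hu₀ : ContDiffOn ℝ ∞ u₀ (closure Ω))
    (hp₀ : ContDiffOn ℝ ∞ (p 0) (closure Ω))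
    (hlaminar : LaminarFlow.IsParallelLaminar Ω u₀ φ s₀ s₂)
    (hprofile : ∃ ρ > 0, ∀ x₂ ∈ Ioo 0 ρ,
      u₀ !₂[0, x₂] = !₂[α₁ * x₂ - α₂ / 2 * x₂ ^ 2, 0]) :
    (∀ s ∈ Icc 0 s₂,
      Tendsto
        (fun x => ⟪LaminarFlow.materialDeriv u 0 x, deriv φ s⟫ / ⟪u₀ x, deriv φ s⟫)
        (𝓝[Ω] (φ s))
        (𝓝 (-(2 * ν * α₂ / (δ * α₁)) - ν / δ ^ 2))) ∧
    -(2 * ν * α₂ / (δ * α₁)) - ν / δ ^ 2 < 0 ∧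
    (∀ δ' ∈ Ioo 0 δ,
      -(2 * ν * α₂ / (δ' * α₁)) - ν / δ' ^ 2 < -(2 * ν * α₂ / (δ * α₁)) - ν / δ ^ 2) := by
  have hud := hΩ.uniqueDiffOn_closure
  have hδ := hφ.δ_pos
  have hdiv : ∀ x ∈ Ω, LaminarFlow.divergence u₀ x = 0 := fun x hx => by
    have h := hu.incompressible 0 ⟨le_rfl, hT⟩ x hx
    rwa [LaminarFlow.divergence, (hu.eventuallyEq_initial hΩ.isOpen hx).fderiv_eq] at h
  obtain ⟨ρ, hρ, hv⟩ := hlaminar.velocity_eq hφ hΩ.isOpen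
    ((hu₀.differentiableOn (by simp)).mono subset_closure) hdiv hprofile
  have hzero : ∀ x ∈ frontier Ω, u₀ x = 0 := fun x hx => by
    rw [← hu.initial x (frontier_subset_closure hx), hu.no_slip 0 ⟨le_rfl, hT⟩ x hx]
  refine ⟨fun s hs => ?_, ?_, fun δ' hδ' => ?_⟩
  · have hs' : s ∈ Icc s₀ s₂ := ⟨hφ.s₀_neg.le.trans hs.1, hs.2⟩
    have hfr := hφ.mem_frontier s
    obtain ⟨U, hU, hxU, g, hg, hg0, hdg, hgΩ⟩ := hΩ.smooth_boundary _ hfr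
    have hgd : DifferentiableAt ℝ g (φ s) :=
      (hg.differentiableOn (by simp)).differentiableAt (hU.mem_nhds hxU)
    have hG : ContDiffOn ℝ ∞ (fun x => ⟪u₀ x, deriv φ s⟫) (closure Ω) :=
      hu₀.inner ℝ contDiffOn_const
    have hF := LaminarFlow.contDiffOn_forceClosure hud hu₀ hp₀ ν (deriv φ s)
    have hFn := hφ.fderivWithin_forceClosure hΩ hu₀ hp₀ hρ hv
      (fun w x hx => hu.forceClosure_frontier hΩ hT hu₀ hp₀ w hx) hs
    have hGn : fderivWithin ℝ (fun x => ⟪u₀ x, deriv φ s⟫) (closure Ω) (φ s)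
        (LaminarFlow.perp (deriv φ s)) = α₁ := by
      refine hφ.fderivWithin_perp (k := fun r => α₁ * r - α₂ / 2 * r ^ 2) hρ
        (fun r hr => (hv s hs' r hr).1) (hG.differentiableOn (by simp)) (fun r hr => ?_) ?_
      · rcases hr.1.eq_or_lt with h | h
        · rw [← h, LaminarFlow.normalCoord_zero, hzero _ hfr]; simp
        · rw [(hv s hs' r ⟨h, hr.2⟩).2, inner_smul_left,
            LaminarFlow.inner_self_of_norm_one (hφ.unit_speed s)]
          simp
      · have h := ((hasDerivAt_id (0 : ℝ)).const_mul α₁).sub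
          (((hasDerivAt_id (0 : ℝ)).pow 2).const_mul (α₂ / 2))
        exact h.congr_deriv (by simp)
    -- L'Hôpital is applied to the force, which is smooth up to the boundary; it agrees with the
    -- material derivative inside `Ω`, where the limit is taken.
    have hlim := hΩ.tendsto_div (hF.of_le (by simp)) (hG.of_le (by simp))
      (fun x hx => hu.forceClosure_frontier hΩ hT hu₀ hp₀ _ hx)
      (fun x hx => by rw [hzero x hx, inner_zero_left]) hfr hU hxU hg.continuousOn hgd hg0 hgΩ
      (hφ.fderiv_perp_pos hΩ.isOpen hs' hU hxU hgd hg0 (hdg _ hxU) hgΩ)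
      (by rw [hGn]; exact hα₁.ne')
    rw [hFn, hGn] at hlim
    have hval : (-(2 * ν * α₂ / δ) - ν * α₁ / δ ^ 2) / α₁ =
        -(2 * ν * α₂ / (δ * α₁)) - ν / δ ^ 2 := by
      field_simp
    rw [hval] at hlim
    refine hlim.congr' ?_
    filter_upwards [self_mem_nhdsWithin] with x hx
    rw [hu.forceClosure_eq hΩ.isOpen hT _ hx]
  · have h1 : 0 < 2 * ν * α₂ / (δ * α₁) := by positivity
    have h2 : 0 < ν / δ ^ 2 := by positivity
    linarith
  · have h0 := hδ'.1
    have h1 : 2 * ν * α₂ / (δ * α₁) < 2 * ν * α₂ / (δ' * α₁) :=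
      div_lt_div_of_pos_left (by positivity) (by positivity)
        (mul_lt_mul_of_pos_right hδ'.2 hα₁)
    have h2 : ν / δ ^ 2 < ν / δ' ^ 2 :=
      div_lt_div_of_pos_left hν (by positivity) (pow_lt_pow_left₀ hδ'.2 h0.le two_ne_zero)
    linarith
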